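/- Let $q\in\mathbb C$ with $0<|q|<1$. Let $C(U_q(2))$ be the universal unital $C^*$-algebra generated by $a,b,D$ with relations $ba=qab$, $a^*b=qba^*$, $bb^*=b^*b$, $aa^*+bb^*=1$, $aD=Da$, $bD=q^2|q|^{-2}Db$, $DD^*=D^*D=1$, $a^*a+|q|^2b^*b=1$, with comultiplication $\Delta(a)=a\otimes a-\bar q\,b\otimes Db^*$, $\Delta(b)=a\otimes b+b\otimes Da^*$, $\Delta(D)=D\otimes D$. Let $h$ be its Haar state, that is, the state with $(h\otimes\mathrm{id})\Delta(x)=h(x)1=(\mathrm{id}\otimes h)\Delta(x)$ for all $x$ in the $*$-algebra $\mathcal O(U_q(2))$ generated by $a,b,D$, and let $L^2(h)$ be its GNS space, on which $x\in C(U_q(2))$ acts through the GNS representation, written $x\triangleright v$. Put $c=-\bar q Db^*$, $d=Da^*$, $|n|_{x}=\frac{x^{n}-x^{-n}}{x-x^{-1}}$, and let $\binom nk_{x}$ be the Gaussian binomial coefficient, $\binom nk_x=\prod_{s=1}^{k}\frac{1-x^{n-k+s}}{1-x^{s}}$. For $\ell\in\frac12\mathbb N$, $i,j\in\{-\ell,-\ell+1,\dots,\ell\}$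 and $k\in\mathbb Z$ put $$t^\ell_{i,j}=\sum_{\substack{m+n=\ell-i\\0\le m\le\ell-j\\0\le n\le\ell+j}}q^{n(\ell-j-m)}\frac{\binom{2\ell}{\ell+j}_{|q|^2}^{1/2}}{\binom{2\ell}{\ell+i}_{|q|^2}^{1/2}}\binom{\ell-j}{m}_{|q|^2}\binom{\ell+j}{n}_{|q|^2}a^mc^{\ell-j-m}b^nd^{\ell+j-n},$$ $$e^\ell_{i,j,k}=|q|^{-i}\sqrt{|2\ell+1|_{|q|}}\;t^\ell_{i,j}(D^*)^k\in L^2(h),$$ and put $e^{\ell}_{i,j,k}=0$ for all other indices (terms containing such a vector are absent). Write $\sqrt{q/\bar q}$ for $q/|q|$, i.e. for $e^{\sqrt{-1}\,\pi\theta}$ if $q=|q|e^{\sqrt{-1}\,\pi\theta}$. Then the vectors $e^\ell_{i,j,k}$ ($\ell\in\frac12\mathbb N$, $i,j\in\{-\ell,\dots,\ell\}$, $k\in\mathbb Z$) form an orthonormal basis of $L^2(h)$, and the generators act on it by (i) $D\triangleright e^\ell_{i,j,k}=(q/\bar q)^{i-j}e^\ell_{i,j,k-1}$; (ii) $D^*\triangleright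 e^\ell_{i,j,k}=(\bar q/q)^{i-j}e^\ell_{i,j,k+1}$; (iii) $b\triangleright e^\ell_{i,j,k}=\beta_+(\ell,i,j)\,e^{\ell+1/2}_{i-1/2,j+1/2,k}+\beta_-(\ell,i,j)\,e^{\ell-1/2}_{i-1/2,j+1/2,k-1}$; (iv) $b^*\triangleright e^\ell_{i,j,k}=\beta^+_+(\ell,i,j)\,e^{\ell+1/2}_{i+1/2,j-1/2,k+1}+\beta^+_-(\ell,i,j)\,e^{\ell-1/2}_{i+1/2,j-1/2,k}$; (v) $a\triangleright e^\ell_{i,j,k}=\alpha_+(\ell,i,j)\,e^{\ell+1/2}_{i-1/2,j-1/2,k}+\alpha_-(\ell,i,j)\,e^{\ell-1/2}_{i-1/2,j-1/2,k-1}$; (vi) $a^*\triangleright e^\ell_{i,j,k}=\alpha^+_+(\ell,i,j)\,e^{\ell+1/2}_{i+1/2,j+1/2,k+1}+\alpha^+_-(\ell,i,j)\,e^{\ell-1/2}_{i+1/2,j+1/2,k}$; where $$\beta_+=q^{\ell-j}\sqrt{\tfrac{(1-|q|^{2(\ell+j+1)})(1-|q|^{2(\ell-i+1)})}{(1-|q|^{2(2\ell+1)})(1-|q|^{2(2\ell+2)})}},\qquad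 \beta_-=-q^{\ell-j-1}\bar q^{\,j-i+1}\sqrt{\tfrac q{\bar q}}\sqrt{\tfrac{(1-|q|^{2(\ell-j)})(1-|q|^{2(\ell+i)})}{(1-|q|^{2(2\ell)})(1-|q|^{2(2\ell+1)})}},$$ $$\beta^+_+=-q^{j-i-1}\bar q^{\,\ell-j+1}\sqrt{\tfrac q{\bar q}}\sqrt{\tfrac{(1-|q|^{2(\ell-j+1)})(1-|q|^{2(\ell+i+1)})}{(1-|q|^{2(2\ell+1)})(1-|q|^{2(2\ell+2)})}},\qquad \beta^+_-=\bar q^{\,\ell-j}\sqrt{\tfrac{(1-|q|^{2(\ell+j)})(1-|q|^{2(\ell-i)})}{(1-|q|^{2(2\ell)})(1-|q|^{2(2\ell+1)})}},$$ $$\alpha_+=\sqrt{\tfrac{(1-|q|^{2(\ell-j+1)})(1-|q|^{2(\ell-i+1)})}{(1-|q|^{2(2\ell+1)})(1-|q|^{2(2\ell+2)})}},\qquad \alpha_-=q^{\ell-j}\bar q^{\,\ell-i+1}\sqrt{\tfrac q{\bar q}}\sqrt{\tfrac{(1-|q|^{2(\ell+j)})(1-|q|^{2(\ell+i)})}{(1-|q|^{2(2\ell)})(1-|q|^{2(2\ell+1)})}},$$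 $$\alpha^+_+=q^{\ell-i}\bar q^{\,\ell-j+1}\sqrt{\tfrac q{\bar q}}\sqrt{\tfrac{(1-|q|^{2(\ell+j+1)})(1-|q|^{2(\ell+i+1)})}{(1-|q|^{2(2\ell+1)})(1-|q|^{2(2\ell+2)})}},\qquad \alpha^+_-=\sqrt{\tfrac{(1-|q|^{2(\ell-j)})(1-|q|^{2(\ell-i)})}{(1-|q|^{2(2\ell)})(1-|q|^{2(2\ell+1)})}}.$$ (For $\ell=0$ the coefficients with subscript $-$ are not needed, since their vectors are $0$.) -/

import Mathlib

open scoped TensorProduct ComplexOrder ENNReal ComplexConjugate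

noncomputable section

namespace Uq2

/-! ## The universal C*-algebra `C(U_q(2))` -/

/-- The defining relations of `C(U_q(2))` for elements `a, b, D` of a complex *-algebra. -/
structure Relations (q : ℂ) {B : Type*} [Ring B] [StarRing B] [Algebra ℂ B] (a b D : B) :
    Prop where
  ba : b * a = q • (a * b)
  as_b : star a * b = q • (b * star a)
  b_bs : b * star b = star b * b
  a_as : a * star a + b * star b = 1
  aD : a * D = D * a
  bD : b * D = (q ^ 2 * ((‖q‖ : ℂ) ^ 2)⁻¹) • (D * b)
  D_Ds : D * star D = 1
  Ds_D : star D * D = 1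
  as_a : star a * a + ((‖q‖ : ℂ) ^ 2) • (star b * b) = 1

/-- A realisation of the relations in a nonzero unital C*-algebra. -/
structure Realization (q : ℂ) : Type 1 where
  carrier : Type
  [cstar : CStarAlgebra carrier]
  [nontriv : Nontrivial carrier]
  a : carrier
  b : carrier
  D : carrier
  rel : Relations q a b D

instance (q : ℂ) (ρ : Realization q) : CStarAlgebra ρ.carrier := ρ.cstar

instance (q : ℂ) (ρ : Realization q) : Nontrivial ρ.carrier := ρ.nontriv

theorem norm_le_one_of_sum {B : Type*} [CStarAlgebra B] {x y : B}
    (h : x * star x + y * star y = 1) : ‖x‖ ≤ 1 ∧ ‖y‖ ≤ 1 := by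
  let _ : PartialOrder B := CStarAlgebra.spectralOrder B
  have _ : StarOrderedRing B := CStarAlgebra.spectralOrderedRing B
  have key : ∀ u v : B, u * star u + v * star v = 1 → ‖u‖ ≤ 1 := by
    intro u v huv
    have h1 : u * star u ≤ 1 := by
      rw [← huv]
      exact le_add_of_nonneg_right (mul_star_self_nonneg v)
    have h2 := (CStarAlgebra.norm_le_one_iff_of_nonneg _ (mul_star_self_nonneg u)).2 h1
    rw [CStarRing.norm_self_mul_star] at h2
    nlinarith [norm_nonneg u]
  exact ⟨key x y h, key y x (by rw [add_comm]; exact h)⟩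

/-- The product (of bounded families) of all realisations. -/
abbrev Big (q : ℂ) : Type 1 := lp (fun ρ : Realization q => ρ.carrier) ∞

instance (q : ℂ) : CStarAlgebra (Big q) where

/-- A bounded family, as an element of the product. -/
def mkBig (q : ℂ) (f : ∀ ρ : Realization q, ρ.carrier) (hf : ∀ ρ, ‖f ρ‖ ≤ 1) : Big q :=
  ⟨f, memℓp_infty ⟨1, by rintro _ ⟨ρ, rfl⟩; exact hf ρ⟩⟩

def bigA (q : ℂ) : Big q := mkBig q (fun ρ => ρ.a) fun ρ => (norm_le_one_of_sum ρ.rel.a_as).1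

def bigB (q : ℂ) : Big q := mkBig q (fun ρ => ρ.b) fun ρ => (norm_le_one_of_sum ρ.rel.a_as).2

def bigD (q : ℂ) : Big q := mkBig q (fun ρ => ρ.D) fun ρ =>
  (norm_le_one_of_sum (x := ρ.D) (y := 0) (by simp [ρ.rel.D_Ds])).1

/-- The C*-subalgebra of the product generated by the universal `a, b, D`. -/
def univSub (q : ℂ) : StarSubalgebra ℂ (Big q) :=
  (StarAlgebra.adjoin ℂ {bigA q, bigB q, bigD q}).topologicalClosure

instance (q : ℂ) : IsClosed (univSub q : Set (Big q)) :=
  StarSubalgebra.isClosed_topologicalClosure _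

/-- `C(U_q(2))`: the universal unital C*-algebra on `a, b, D` subject to the relations, i.e. the
completion of the *-algebra in the supremum of the norms of all its realisations (see
`exists_unique_lift` for the universal property). -/
def CUq2 (q : ℂ) : Type 1 := univSub q

instance (q : ℂ) : CStarAlgebra (CUq2 q) := inferInstanceAs (CStarAlgebra (univSub q))

instance (q : ℂ) : PartialOrder (CUq2 q) := CStarAlgebra.spectralOrder (CUq2 q)

instance (q : ℂ) : StarOrderedRing (CUq2 q) := CStarAlgebra.spectralOrderedRing (CUq2 q)

theorem mem_univSub (q : ℂ) {x : Big q} (hx : x ∈ ({bigA q, bigB q, bigD q} : Set (Big q))) :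
    x ∈ univSub q :=
  StarSubalgebra.le_topologicalClosure _ (StarAlgebra.subset_adjoin ℂ _ hx)

/-- The generators of `C(U_q(2))`. -/
def gA (q : ℂ) : CUq2 q := (⟨bigA q, mem_univSub q (by simp)⟩ : univSub q)

def gB (q : ℂ) : CUq2 q := (⟨bigB q, mem_univSub q (by simp)⟩ : univSub q)

def gD (q : ℂ) : CUq2 q := (⟨bigD q, mem_univSub q (by simp)⟩ : univSub q)

/-- Evaluation of `C(U_q(2))` at a realisation. -/
def evalHom (q : ℂ) (ρ : Realization q) : CUq2 q →⋆ₐ[ℂ] ρ.carrier where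
  toFun x := (x : univSub q).1 ρ
  map_one' := rfl
  map_mul' _ _ := rfl
  map_zero' := rfl
  map_add' _ _ := rfl
  commutes' _ := rfl
  map_star' _ := rfl

theorem ext_eval (q : ℂ) {x y : CUq2 q} (h : ∀ ρ, evalHom q ρ x = evalHom q ρ y) : x = y :=
  Subtype.ext (Subtype.ext (funext h))

theorem relations_gen (q : ℂ) : Relations q (gA q) (gB q) (gD q) := by
  have ea : ∀ ρ, evalHom q ρ (gA q) = ρ.a := fun _ => rfl
  have eb : ∀ ρ, evalHom q ρ (gB q) = ρ.b := fun _ => rfl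
  have ed : ∀ ρ, evalHom q ρ (gD q) = ρ.D := fun _ => rfl
  constructor <;> refine ext_eval q fun ρ => ?_ <;>
    simp only [map_mul, map_add, map_smul, map_star, map_one, ea, eb, ed]
  exacts [ρ.rel.ba, ρ.rel.as_b, ρ.rel.b_bs, ρ.rel.a_as, ρ.rel.aD, ρ.rel.bD, ρ.rel.D_Ds,
    ρ.rel.Ds_D, ρ.rel.as_a]

/-- Two *-homomorphisms out of `C(U_q(2))` that agree on the generators are equal. -/
theorem hom_ext (q : ℂ) {B : Type*} [CStarAlgebra B] {φ ψ : CUq2 q →⋆ₐ[ℂ] B}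
    (ha : φ (gA q) = ψ (gA q)) (hb : φ (gB q) = ψ (gB q)) (hd : φ (gD q) = ψ (gD q)) :
    φ = ψ := by
  have hc : ∀ χ : CUq2 q →⋆ₐ[ℂ] B, Continuous χ := fun χ =>
    AddMonoidHomClass.continuous_of_bound χ 1 fun x => by
      simpa using NonUnitalStarAlgHom.norm_apply_le (χ : CUq2 q →⋆ₙₐ[ℂ] B) x
  refine StarAlgHom.ext_topologicalClosure
    (S := StarAlgebra.adjoin ℂ {bigA q, bigB q, bigD q}) (hc φ) (hc ψ) ?_
  refine StarAlgHom.ext_adjoin ?_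
  rintro ⟨_, hx⟩ (rfl | rfl | rfl)
  exacts [ha, hb, hd]

/-- The universal property of `C(U_q(2))`. -/
theorem exists_unique_lift (q : ℂ) {B : Type} [CStarAlgebra B] {a b D : B}
    (h : Relations q a b D) :
    ∃! φ : CUq2 q →⋆ₐ[ℂ] B, φ (gA q) = a ∧ φ (gB q) = b ∧ φ (gD q) = D := by
  have huniq : ∀ φ ψ : CUq2 q →⋆ₐ[ℂ] B,
      (φ (gA q) = a ∧ φ (gB q) = b ∧ φ (gD q) = D) →
      (ψ (gA q) = a ∧ ψ (gB q) = b ∧ ψ (gD q) = D) → φ = ψ := by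
    rintro φ ψ ⟨h1, h2, h3⟩ ⟨h4, h5, h6⟩
    exact hom_ext q (h1.trans h4.symm) (h2.trans h5.symm) (h3.trans h6.symm)
  suffices hex : ∃ φ : CUq2 q →⋆ₐ[ℂ] B, φ (gA q) = a ∧ φ (gB q) = b ∧ φ (gD q) = D by
    obtain ⟨φ, hφ⟩ := hex
    exact ⟨φ, hφ, fun ψ hψ => huniq ψ φ hψ hφ⟩
  rcases subsingleton_or_nontrivial B with hB | hB
  · exact ⟨{ toFun := fun _ => 0
             map_one' := Subsingleton.elim _ _
             map_mul' := fun _ _ => Subsingleton.elim _ _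
             map_zero' := rfl
             map_add' := fun _ _ => Subsingleton.elim _ _
             commutes' := fun _ => Subsingleton.elim _ _
             map_star' := fun _ => Subsingleton.elim _ _ },
      Subsingleton.elim _ _, Subsingleton.elim _ _, Subsingleton.elim _ _⟩
  · exact ⟨evalHom q ⟨B, a, b, D, h⟩, rfl, rfl, rfl⟩

/-! ## The Hopf algebra `O(U_q(2))` and the Haar state -/

/-- The letters `a, a*, b, b*, D, D*`. -/
inductive Letter
  | a | as | b | bs | D | Ds

/-- The free algebra on the six letters. -/
abbrev Words : Type := FreeAlgebra ℂ Letter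

/-- A letter as an element of the free algebra. -/
abbrev lt (x : Letter) : Words := FreeAlgebra.ι ℂ x

open Letter in
/-- The defining relations of `U_q(2)` together with their adjoints. -/
inductive PolyRel (q : ℂ) : Words → Words → Prop
  | ba : PolyRel q (lt b * lt a) (q • (lt a * lt b))
  | as_bs : PolyRel q (lt as * lt bs) (conj q • (lt bs * lt as))
  | as_b : PolyRel q (lt as * lt b) (q • (lt b * lt as))
  | bs_a : PolyRel q (lt bs * lt a) (conj q • (lt a * lt bs))
  | b_bs : PolyRel q (lt b * lt bs) (lt bs * lt b)
  | a_as : PolyRel q (lt a * lt as + lt b * lt bs) 1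
  | aD : PolyRel q (lt a * lt D) (lt D * lt a)
  | Ds_as : PolyRel q (lt Ds * lt as) (lt as * lt Ds)
  | bD : PolyRel q (lt b * lt D) ((q ^ 2 * ((‖q‖ : ℂ) ^ 2)⁻¹) • (lt D * lt b))
  | Ds_bs : PolyRel q (lt Ds * lt bs)
      ((conj q ^ 2 * ((‖q‖ : ℂ) ^ 2)⁻¹) • (lt bs * lt Ds))
  | D_Ds : PolyRel q (lt D * lt Ds) 1
  | Ds_D : PolyRel q (lt Ds * lt D) 1
  | as_a : PolyRel q (lt as * lt a + ((‖q‖ : ℂ) ^ 2) • (lt bs * lt b)) 1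

/-- The coordinate algebra `O(U_q(2))`: the *-algebra presented by `a, b, D` and the relations,
written as the algebra on the letters and their adjoints. -/
abbrev Poly (q : ℂ) : Type := RingQuot (PolyRel q)

/-- The class of a letter in `O(U_q(2))`. -/
def g (q : ℂ) (x : Letter) : Poly q := RingQuot.mkAlgHom ℂ (PolyRel q) (lt x)

/-- The values of the canonical map `O(U_q(2)) → C(U_q(2))` on the letters. -/
def toCLetter (q : ℂ) : Letter → CUq2 q
  | .a => gA q
  | .as => star (gA q)
  | .b => gB q
  | .bs => star (gB q)
  | .D => gD q
  | .Ds => star (gD q)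

/-- The canonical map `O(U_q(2)) → C(U_q(2))`. -/
def toC (q : ℂ) : Poly q →ₐ[ℂ] CUq2 q :=
  RingQuot.liftAlgHom ℂ ⟨FreeAlgebra.lift ℂ (toCLetter q), by
    have R := relations_gen q
    intro x y hxy
    cases hxy <;>
      simp only [map_mul, map_add, map_smul, map_one, FreeAlgebra.lift_ι_apply, toCLetter]
    · exact R.ba
    · simpa using congrArg star R.ba
    · exact R.as_b
    · simpa using congrArg star R.as_b
    · exact R.b_bs
    · exact R.a_as
    · exact R.aD
    · simpa using congrArg star R.aD
    · exact R.bD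
    · simpa using congrArg star R.bD
    · exact R.D_Ds
    · exact R.Ds_D
    · exact R.as_a⟩

open Letter in
/-- The values of the comultiplication on the letters. -/
def comulLetter (q : ℂ) : Letter → Poly q ⊗[ℂ] Poly q
  | .a => g q a ⊗ₜ g q a + (-conj q) • (g q b ⊗ₜ (g q D * g q bs))
  | .as => g q as ⊗ₜ g q as + (-q) • (g q bs ⊗ₜ (g q b * g q Ds))
  | .b => g q a ⊗ₜ g q b + g q b ⊗ₜ (g q D * g q as)
  | .bs => g q as ⊗ₜ g q bs + g q bs ⊗ₜ (g q a * g q Ds)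
  | .D => g q D ⊗ₜ g q D
  | .Ds => g q Ds ⊗ₜ g q Ds

section relations

open Letter

variable (q : ℂ)

theorem g_rel {x y : Words} (h : PolyRel q x y) :
    RingQuot.mkAlgHom ℂ (PolyRel q) x = RingQuot.mkAlgHom ℂ (PolyRel q) y :=
  RingQuot.mkAlgHom_rel ℂ h

theorem g_ba : g q b * g q a = q • (g q a * g q b) := by
  simpa [g] using g_rel q .ba
theorem g_as_bs : g q as * g q bs = conj q • (g q bs * g q as) := by
  simpa [g] using g_rel q .as_bs
theorem g_as_b : g q as * g q b = q • (g q b * g q as) := by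
  simpa [g] using g_rel q .as_b
theorem g_bs_a : g q bs * g q a = conj q • (g q a * g q bs) := by
  simpa [g] using g_rel q .bs_a
theorem g_bs_b : g q bs * g q b = g q b * g q bs := by
  simpa [g] using (g_rel q .b_bs).symm
theorem g_a_as : g q a * g q as = 1 + (-1 : ℂ) • (g q b * g q bs) := by
  have h : g q a * g q as + g q b * g q bs = 1 := by simpa [g] using g_rel q .a_as
  rw [← h]; module
theorem g_aD : g q a * g q D = g q D * g q a := by
  simpa [g] using g_rel q .aD
theorem g_asDs : g q as * g q Ds = g q Ds * g q as := by
  simpa [g] using (g_rel q .Ds_as).symm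
theorem g_bD : g q b * g q D = (q ^ 2 * ((‖q‖ : ℂ) ^ 2)⁻¹) • (g q D * g q b) := by
  simpa [g] using g_rel q .bD
theorem g_Ds_bs :
    g q Ds * g q bs = (conj q ^ 2 * ((‖q‖ : ℂ) ^ 2)⁻¹) • (g q bs * g q Ds) := by
  simpa [g] using g_rel q .Ds_bs
theorem g_D_Ds : g q D * g q Ds = 1 := by simpa [g] using g_rel q .D_Ds
theorem g_Ds_D : g q Ds * g q D = 1 := by simpa [g] using g_rel q .Ds_D
theorem g_as_a : g q as * g q a = 1 + (-(‖q‖ : ℂ) ^ 2) • (g q b * g q bs) := by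
  have h : g q as * g q a + ((‖q‖ : ℂ) ^ 2) • (g q b * g q bs) = 1 := by
    rw [← g_bs_b]; simpa [g] using g_rel q .as_a
  rw [← h]; module

theorem assoc_of {x y z : Poly q} (h : x * y = z) (w : Poly q) : x * (y * w) = z * w := by
  rw [← mul_assoc, h]

theorem g_asD : g q as * g q D = g q D * g q as := by
  calc g q as * g q D = g q D * (g q Ds * g q as) * g q D := by
        rw [← mul_assoc, g_D_Ds, one_mul]
    _ = g q D * g q as := by rw [← g_asDs, mul_assoc, mul_assoc, g_Ds_D, mul_one]

theorem g_aDs : g q a * g q Ds = g q Ds * g q a := by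
  calc g q a * g q Ds = g q Ds * (g q D * g q a) * g q Ds := by
        rw [← mul_assoc, g_Ds_D, one_mul]
    _ = g q Ds * g q a := by rw [← g_aD, mul_assoc, mul_assoc, g_D_Ds, mul_one]

theorem g_bsD : g q bs * g q D = (conj q ^ 2 * ((‖q‖ : ℂ) ^ 2)⁻¹) • (g q D * g q bs) := by
  calc g q bs * g q D = g q D * (g q Ds * g q bs) * g q D := by
        rw [← mul_assoc, g_D_Ds, one_mul]
    _ = _ := by
      rw [g_Ds_bs, mul_smul_comm, smul_mul_assoc, mul_assoc, mul_assoc, g_Ds_D, mul_one]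

variable {q}

theorem norm_sq_eq (q : ℂ) : (‖q‖ : ℂ) ^ 2 = q * conj q := by
  rw [Complex.mul_conj, Complex.normSq_eq_norm_sq]; norm_cast

theorem phase_mul (hq : q ≠ 0) :
    (conj q ^ 2 * ((‖q‖ : ℂ) ^ 2)⁻¹) * (q ^ 2 * ((‖q‖ : ℂ) ^ 2)⁻¹) = 1 := by
  have : conj q ≠ 0 := (map_ne_zero _).2 hq
  rw [norm_sq_eq]; field_simp

theorem g_bDs (hq : q ≠ 0) :
    g q b * g q Ds = (conj q ^ 2 * ((‖q‖ : ℂ) ^ 2)⁻¹) • (g q Ds * g q b) := by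
  have h : g q Ds * g q b = (q ^ 2 * ((‖q‖ : ℂ) ^ 2)⁻¹) • (g q b * g q Ds) := by
    calc g q Ds * g q b = g q Ds * (g q b * g q D) * g q Ds := by
          rw [mul_assoc, mul_assoc, g_D_Ds, mul_one]
      _ = _ := by
        rw [g_bD, mul_smul_comm, smul_mul_assoc, ← mul_assoc, g_Ds_D, one_mul]
  rw [h, smul_smul, phase_mul hq, one_smul]

theorem g_bsDs (hq : q ≠ 0) :
    g q bs * g q Ds = (q ^ 2 * ((‖q‖ : ℂ) ^ 2)⁻¹) • (g q Ds * g q bs) := by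
  rw [g_Ds_bs, smul_smul, mul_comm, phase_mul hq, one_smul]

theorem g_b_zero (hq : q = 0) : g q b = 0 := by
  have h := congrArg (· * g q Ds) (g_bD q)
  simpa [mul_assoc, g_D_Ds, hq] using h

theorem g_bs_zero (hq : q = 0) : g q bs = 0 := by
  have h := congrArg (· * g q Ds) (g_bsD q)
  simpa [mul_assoc, g_D_Ds, hq] using h

end relations

/-- The comultiplication is compatible with the relations. -/
theorem comul_rel (q : ℂ) {x y : Words} (h : PolyRel q x y) :
    FreeAlgebra.lift ℂ (comulLetter q) x = FreeAlgebra.lift ℂ (comulLetter q) y := by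
  by_cases hq : q = 0
  · cases h <;>
    simp [comulLetter, Algebra.TensorProduct.one_def, g_b_zero hq, g_bs_zero hq, g_D_Ds, g_Ds_D,
      g_aD, g_asDs, g_a_as, g_as_a]
  have hc : conj q ≠ 0 := (map_ne_zero _).2 hq
  cases h <;>
    simp only [map_mul, map_add, map_smul, map_one, FreeAlgebra.lift_ι_apply, comulLetter,
      Algebra.TensorProduct.one_def]
  all_goals simp only [Algebra.TensorProduct.tmul_mul_tmul, mul_assoc, g_ba, g_as_bs, g_as_b,
      g_bs_a, g_bs_b, g_a_as, g_aD, g_asDs, g_bD, g_D_Ds, g_Ds_D, g_as_a, g_asD, g_aDs, g_bsD,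
      g_bDs hq, g_bsDs hq,
      assoc_of q (g_ba q), assoc_of q (g_as_bs q), assoc_of q (g_as_b q), assoc_of q (g_bs_a q),
      assoc_of q (g_bs_b q), assoc_of q (g_a_as q), assoc_of q (g_aD q), assoc_of q (g_asDs q),
      assoc_of q (g_bD q), assoc_of q (g_D_Ds q), assoc_of q (g_Ds_D q),
      assoc_of q (g_as_a q), assoc_of q (g_asD q), assoc_of q (g_aDs q), assoc_of q (g_bsD q),
      assoc_of q (g_bDs hq), assoc_of q (g_bsDs hq), mul_add, add_mul, smul_mul_assoc,
      mul_smul_comm, one_mul, mul_one, TensorProduct.tmul_add, TensorProduct.add_tmul,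
      TensorProduct.tmul_smul, ← TensorProduct.smul_tmul', smul_add, smul_smul, norm_sq_eq]
  all_goals match_scalars <;> field_simp <;> ring

/-- The comultiplication `Δ : O(U_q(2)) → O(U_q(2)) ⊗ O(U_q(2))`,
`Δ(a) = a ⊗ a - q̄ b ⊗ D b*`, `Δ(b) = a ⊗ b + b ⊗ D a*`, `Δ(D) = D ⊗ D`. -/
def comul (q : ℂ) : Poly q →ₐ[ℂ] Poly q ⊗[ℂ] Poly q :=
  RingQuot.liftAlgHom ℂ ⟨FreeAlgebra.lift ℂ (comulLetter q), fun _ _ h => comul_rel q h⟩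

/-- The restriction of a functional on `C(U_q(2))` to `O(U_q(2))`. -/
def restr (q : ℂ) (h : CUq2 q →ₚ[ℂ] ℂ) : Poly q →ₗ[ℂ] ℂ :=
  h.toLinearMap ∘ₗ (toC q).toLinearMap

/-- `h` is the Haar state of `U_q(2)`: a state that is invariant from both sides,
`(h ⊗ id)Δ(x) = h(x) 1 = (id ⊗ h)Δ(x)`. -/
structure IsHaarState (q : ℂ) (h : CUq2 q →ₚ[ℂ] ℂ) : Prop where
  map_one : h 1 = 1
  left_invariant : ∀ x : Poly q,
    TensorProduct.lid ℂ (Poly q) ((restr q h).rTensor (Poly q) (comul q x)) = restr q h x • 1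
  right_invariant : ∀ x : Poly q,
    TensorProduct.rid ℂ (Poly q) ((restr q h).lTensor (Poly q) (comul q x)) = restr q h x • 1

/-! ## The vectors `e^ℓ_{i,j,k}`

The half-integers `ℓ, i, j` are represented by the integers `L = 2ℓ`, `I = 2i`, `J = 2j`. -/

/-- `ℓ ∈ ½ℕ` and `i, j ∈ {-ℓ, -ℓ + 1, …, ℓ}`. -/
def IsIndex (L I J : ℤ) : Prop :=
  |I| ≤ L ∧ |J| ≤ L ∧ Even (L - I) ∧ Even (L - J)

/-- The `x`-factorial `∏_{s=1}^{n} (1 - x^s) / (1 - x)`. -/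
def qFactorial (x : ℝ) (n : ℕ) : ℝ := ∏ s ∈ Finset.range n, (1 - x ^ (s + 1)) / (1 - x)

/-- The Gaussian binomial coefficient `(n choose k)_x` (for `k ≤ n`). -/
def qBinomial (x : ℝ) (n k : ℕ) : ℝ :=
  qFactorial x n / (qFactorial x k * qFactorial x (n - k))

/-- The symmetric `x`-number `|n|_x = (x^n - x^{-n}) / (x - x^{-1})`. -/
def qNumber (x : ℝ) (n : ℤ) : ℝ := (x ^ n - x ^ (-n)) / (x - x⁻¹)

/-- `c = -q̄ D b*`. -/
def cElem (q : ℂ) : CUq2 q := (-conj q) • (gD q * star (gB q))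

/-- `d = D a*`. -/
def dElem (q : ℂ) : CUq2 q := gD q * star (gA q)

/-- `(D*)^k = D^{-k}` for an integer `k`. -/
def dStarPow (q : ℂ) (k : ℤ) : CUq2 q :=
  if 0 ≤ k then star (gD q) ^ k.toNat else gD q ^ (-k).toNat

/-- The matrix coefficient `t^ℓ_{i,j}`; here `P = ℓ - j`, `R = ℓ + j`, and the sum runs over
`m + n = ℓ - i`, `m ≤ ℓ - j`, `n ≤ ℓ + j`. -/
def matCoeff (q : ℂ) (L I J : ℤ) : CUq2 q :=
  let P : ℕ := ((L - J) / 2).toNat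
  let R : ℕ := ((L + J) / 2).toNat
  ∑ p ∈ (Finset.HasAntidiagonal.antidiagonal ((L - I) / 2).toNat).filter (fun p => p.1 ≤ P ∧ p.2 ≤ R),
    (q ^ (p.2 * (P - p.1)) *
      ((√(qBinomial (‖q‖ ^ 2) L.toNat R) /
          √(qBinomial (‖q‖ ^ 2) L.toNat ((L + I) / 2).toNat) *
        qBinomial (‖q‖ ^ 2) P p.1 * qBinomial (‖q‖ ^ 2) R p.2 : ℝ) : ℂ)) •
      (gA q ^ p.1 * cElem q ^ (P - p.1) * gB q ^ p.2 * dElem q ^ (R - p.2))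

open Classical in
/-- The element `|q|^{-i} √|2ℓ+1|_{|q|} t^ℓ_{i,j} (D*)^k` of `C(U_q(2))`, and `0` by convention if
`(ℓ, i, j)` is not an admissible index. -/
def eElem (q : ℂ) (L I J k : ℤ) : CUq2 q :=
  if IsIndex L I J then
    ((‖q‖ ^ (-(I : ℝ) / 2) * √(qNumber ‖q‖ (L + 1)) : ℝ) : ℂ) • (matCoeff q L I J * dStarPow q k)
  else 0

/-- The vector `e^ℓ_{i,j,k}` in the GNS Hilbert space `L²(h)`. -/
def eVec (q : ℂ) (h : CUq2 q →ₚ[ℂ] ℂ) (L I J k : ℤ) : h.GNS :=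
  ((h.toPreGNS (eElem q L I J k) : h.PreGNS) : h.GNS)

/-- The admissible indices `(ℓ, i, j, k)`. -/
def Index : Type := {p : ℤ × ℤ × ℤ × ℤ // IsIndex p.1 p.2.1 p.2.2.1}

/-- The family of all `e^ℓ_{i,j,k}` with admissible indices. -/
def eFamily (q : ℂ) (h : CUq2 q →ₚ[ℂ] ℂ) (p : Index) : h.GNS :=
  eVec q h p.1.1 p.1.2.1 p.1.2.2.1 p.1.2.2.2

/-! ## The coefficients -/

/-- `√(q / q̄)`, the square root `e^{√-1 π θ}` for `q = |q| e^{√-1 π θ}`. -/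
def phase (q : ℂ) : ℂ := q / ‖q‖

/-- `√((1 - |q|^u) (1 - |q|^v) / ((1 - |q|^w) (1 - |q|^{w + 2})))`. -/
def root (q : ℂ) (u v w : ℤ) : ℂ :=
  ((√((1 - ‖q‖ ^ u) * (1 - ‖q‖ ^ v) / ((1 - ‖q‖ ^ w) * (1 - ‖q‖ ^ (w + 2)))) : ℝ) : ℂ)

/-- `β₊(ℓ, i, j)`; all coefficients are functions of `L = 2ℓ`, `I = 2i`, `J = 2j`. -/
def betaPlus (q : ℂ) (L I J : ℤ) : ℂ :=
  q ^ ((L - J) / 2) * root q (L + J + 2) (L - I + 2) (2 * L + 2)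

/-- `β₋(ℓ, i, j)` -/
def betaMinus (q : ℂ) (L I J : ℤ) : ℂ :=
  -q ^ ((L - J) / 2 - 1) * conj q ^ ((J - I) / 2 + 1) * phase q * root q (L - J) (L + I) (2 * L)

/-- `β₊⁺(ℓ, i, j)` -/
def betaPlusStar (q : ℂ) (L I J : ℤ) : ℂ :=
  -q ^ ((J - I) / 2 - 1) * conj q ^ ((L - J) / 2 + 1) * phase q *
    root q (L - J + 2) (L + I + 2) (2 * L + 2)

/-- `β₋⁺(ℓ, i, j)` -/
def betaMinusStar (q : ℂ) (L I J : ℤ) : ℂ :=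
  conj q ^ ((L - J) / 2) * root q (L + J) (L - I) (2 * L)

/-- `α₊(ℓ, i, j)` -/
def alphaPlus (q : ℂ) (L I J : ℤ) : ℂ := root q (L - J + 2) (L - I + 2) (2 * L + 2)

/-- `α₋(ℓ, i, j)` -/
def alphaMinus (q : ℂ) (L I J : ℤ) : ℂ :=
  q ^ ((L - J) / 2) * conj q ^ ((L - I) / 2 + 1) * phase q * root q (L + J) (L + I) (2 * L)

/-- `α₊⁺(ℓ, i, j)` -/
def alphaPlusStar (q : ℂ) (L I J : ℤ) : ℂ :=
  q ^ ((L - I) / 2) * conj q ^ ((L - J) / 2 + 1) * phase q *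
    root q (L + J + 2) (L + I + 2) (2 * L + 2)

/-- `α₋⁺(ℓ, i, j)` -/
def alphaMinusStar (q : ℂ) (L I J : ℤ) : ℂ := root q (L - J) (L - I) (2 * L)

end Uq2

end

/-!
The matrix coefficient `t^ℓ_{i,j}` is, up to normalisation, the coefficient of
`x^{ℓ-i} y^{ℓ+i}` in `(x a + y c)^{ℓ-j} (x b + y d)^{ℓ+j}`, where `y x = q x y` and `a, b, c, d`
commute with `x` and `y`. Multiplying this product on the left by one more factor gives one linear
relation between the products of the generators with the coefficients of spin `ℓ` and the
coefficients of spin `ℓ + 1/2`; commuting a generator through the product, at the cost of a quantum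
determinant `D` and one factor, gives a second relation involving spin `ℓ - 1/2`. Solving the two
relations yields the action of all generators.

The Haar state kills every coefficient except `1`. Applying a two-dimensional triangular
representation to the second leg of the comultiplication, invariance says that `h` is fixed by a
two-parameter torus, under which the coefficients are weight vectors, and killed by the image of a
raising operator, which contains every coefficient not of highest weight in `j`.

Orthonormality follows by induction on `ℓ`. In the formulas the coefficients of `a*`, `b*` are
formally adjoint to those of `a`, `b`, and `x*` acts on `L²(h)` as the adjoint of `x`, so the inner
products with the vectors of spin `ℓ + 1/2` are determined by those of spin `ℓ` and `ℓ - 1/2`. The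
span of the vectors is dense because it contains `1` and is stable under the generators.
-/

noncomputable section

namespace Uq2

/-! ## Gaussian binomial coefficients -/

section qNumbers

variable {K : Type*} [Field K]

/-- The `x`-integer `[n] = (1 - x^n) / (1 - x)`, for `x ≠ 1`. -/
def qInt (x : K) (n : ℤ) : K := (1 - x ^ n) / (1 - x)

@[simp]
theorem qInt_zero (x : K) : qInt x 0 = 0 := by simp [qInt]

theorem qInt_one {x : K} (hx1 : x ≠ 1) : qInt x 1 = 1 := by
  rw [qInt, zpow_one, div_self (sub_ne_zero.2 hx1.symm)]

theorem qInt_add {x : K} (hx0 : x ≠ 0) (m n : ℤ) :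
    qInt x (m + n) = qInt x m + x ^ m * qInt x n := by
  rw [qInt, qInt, qInt, zpow_add₀ hx0]
  ring

theorem qInt_add_one {x : K} (hx0 : x ≠ 0) (hx1 : x ≠ 1) (n : ℤ) :
    qInt x (n + 1) = qInt x n + x ^ n := by
  rw [qInt_add hx0, qInt_one hx1, mul_one]

theorem map_qInt {K' : Type*} [Field K'] (φ : K →+* K') (x : K) (n : ℤ) :
    φ (qInt x n) = qInt (φ x) n := by
  simp [qInt]

end qNumbers

section gaussBinom

/-- The Gaussian binomial coefficient `(n choose k)_x`, by the Pascal recursion, hence `0` for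
`n < k`. -/
def gaussBinom {S : Type*} [CommSemiring S] (x : S) : ℕ → ℕ → S
  | _, 0 => 1
  | 0, _ + 1 => 0
  | n + 1, k + 1 => gaussBinom x n k + x ^ (k + 1) * gaussBinom x n (k + 1)

variable {S : Type*} [CommSemiring S] (x : S)

@[simp]
theorem gaussBinom_zero_right (n : ℕ) : gaussBinom x n 0 = 1 := by cases n <;> rfl

theorem gaussBinom_succ_succ (n k : ℕ) :
    gaussBinom x (n + 1) (k + 1) = gaussBinom x n k + x ^ (k + 1) * gaussBinom x n (k + 1) :=
  rfl

theorem gaussBinom_of_lt {n k : ℕ} (h : n < k) : gaussBinom x n k = 0 := by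
  induction n generalizing k with
  | zero => obtain ⟨k, rfl⟩ := Nat.exists_eq_succ_of_ne_zero h.ne'; rfl
  | succ n ih =>
    obtain ⟨k, rfl⟩ := Nat.exists_eq_succ_of_ne_zero (Nat.ne_zero_of_lt h)
    rw [gaussBinom_succ_succ, ih (by omega), ih (by omega), mul_zero, add_zero]

theorem map_gaussBinom {S' : Type*} [CommSemiring S'] (φ : S →+* S') (n k : ℕ) :
    φ (gaussBinom x n k) = gaussBinom (φ x) n k := by
  induction n generalizing k with
  | zero => cases k <;> simp [gaussBinom]
  | succ n ih => cases k <;> simp [gaussBinom_succ_succ, ih]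

variable {x} {A : Type*} [Semiring A] [Algebra S A]

theorem mul_pow_of_mul_eq_smul {u v : A} (h : v * u = x • (u * v)) (n : ℕ) :
    v * u ^ n = x ^ n • (u ^ n * v) := by
  induction n with
  | zero => simp
  | succ n ih =>
    rw [pow_succ, ← mul_assoc, ih, smul_mul_assoc, mul_assoc, h, mul_smul_comm, smul_smul,
      ← mul_assoc, pow_succ]

theorem gaussBinom_add_pow {u v : A} (h : v * u = x • (u * v)) (n : ℕ) :
    (u + v) ^ n = ∑ m ∈ Finset.range (n + 1), gaussBinom x n m • (u ^ m * v ^ (n - m)) := by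
  induction n with
  | zero => simp
  | succ n ih =>
    have hv (m : ℕ) (hm : m ∈ Finset.range (n + 1)) :
        v * (gaussBinom x n m • (u ^ m * v ^ (n - m))) =
          (x ^ m * gaussBinom x n m) • (u ^ m * v ^ (n + 1 - m)) := by
      rw [mul_smul_comm, ← mul_assoc, mul_pow_of_mul_eq_smul h, smul_mul_assoc, mul_assoc,
        ← pow_succ', smul_smul, mul_comm, Nat.succ_sub (Finset.mem_range_succ_iff.1 hm)]
    have hlast : x ^ (n + 1) * gaussBinom x n (n + 1) = 0 := by
      rw [gaussBinom_of_lt x n.lt_succ_self, mul_zero]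
    rw [pow_succ', ih, add_mul, Finset.mul_sum, Finset.mul_sum, Finset.sum_congr rfl hv,
      Finset.sum_range_succ' _ (n + 1), ← add_zero (∑ m ∈ Finset.range (n + 1), (x ^ m * _) • _),
      ← zero_smul S (u ^ (n + 1) * v ^ (n + 1 - (n + 1))), ← hlast,
      ← Finset.sum_range_succ (fun m => (x ^ m * gaussBinom x n m) • (u ^ m * v ^ (n + 1 - m))),
      Finset.sum_range_succ' _ (n + 1), ← add_assoc, ← Finset.sum_add_distrib]
    simp only [gaussBinom_succ_succ, add_smul, mul_smul_comm, pow_succ', mul_assoc,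
      Nat.add_sub_add_right, gaussBinom_zero_right, pow_zero, one_mul, Nat.sub_zero]

end gaussBinom

/-! ## Coefficients of a quantum matrix -/

/-- `a, b, c, d` are the entries of a two-parameter quantum `2 × 2` matrix with quantum determinant
`D`. The group `U_q(2)` is the case `p = conj q`. -/
structure IsQuantumMatrix {K A : Type*} [Field K] [Ring A] [Algebra K A] (p q : K)
    (a b c d D : A) : Prop where
  ba : b * a = q • (a * b)
  ca : c * a = p • (a * c)
  cb : c * b = (p / q) • (b * c)
  db : d * b = p • (b * d)
  dc : d * c = q • (c * d)
  ad : a * d = D + q⁻¹ • (b * c)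
  da : d * a = D + p • (b * c)
  aD : a * D = D * a
  bD : b * D = (q / p) • (D * b)
  cD : c * D = (p / q) • (D * c)
  dD : d * D = D * d

section columnStep

variable {K A : Type*} [Field K] [Ring A] [Algebra K A] {p q : K} {α β : A}

/-- A sequence `f : ℤ → A` encodes the element `∑ s, x^s y^{N-s} f(s)` of degree `N` over the
quantum plane `y x = q x y`; this is left multiplication by `x α + y β`, up to `N`. -/
def columnStep (q : K) (α β : A) : Module.End K (ℤ → A) where
  toFun f s := α * f (s - 1) + q ^ s • (β * f s)
  map_add' f g := by ext s; simp only [Pi.add_apply, mul_add, smul_add]; abel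
  map_smul' r f := by ext s; simp [smul_comm r]

theorem columnStep_apply (f : ℤ → A) (s : ℤ) :
    columnStep q α β f s = α * f (s - 1) + q ^ s • (β * f s) := rfl

/-- The lowering operator on sequences of degree `N`; with `columnStep` it inverts the pair of
left multiplications by `α` and `β`, see `qInt_smul_mul_left` and `qInt_smul_mul_right`. -/
def lowering (p q : K) (N : ℤ) (α β : A) (f : ℤ → A) (s : ℤ) : A :=
  (p ^ (s + 1) * qInt (p * q) (N - s)) • (α * f s) - qInt (p * q) (s + 1) • (β * f (s + 1))

theorem lowering_single_zero : lowering p q 0 α β (Pi.single 0 1) = 0 := by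
  ext s
  rcases eq_or_ne s 0 with rfl | h0
  · simp [lowering]
  · rcases eq_or_ne (s + 1) 0 with h1 | h1 <;> simp [lowering, h0, h1]

theorem qInt_smul_mul_left (hx : p * q ≠ 0) (N : ℤ) (f : ℤ → A) (s : ℤ) :
    qInt (p * q) (N + 1) • (α * f s) =
      qInt (p * q) (s + 1) • columnStep q α β f (s + 1) +
        q ^ (s + 1) • lowering p q N α β f s := by
  rw [show N + 1 = s + 1 + (N - s) by ring, qInt_add hx, mul_zpow, columnStep_apply, lowering,
    add_sub_cancel_right]
  module

theorem qInt_smul_mul_right (hx : p * q ≠ 0) (N : ℤ) (f : ℤ → A) (s : ℤ) :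
    qInt (p * q) (N + 1) • (β * f (s + 1)) =
      (p ^ (s + 1) * qInt (p * q) (N - s)) • columnStep q α β f (s + 1) -
        lowering p q N α β f s := by
  rw [show N + 1 = s + 1 + (N - s) by ring, qInt_add hx, mul_zpow, columnStep_apply, lowering,
    add_sub_cancel_right]
  module

/-- The two summands of `columnStep` are themselves operators `u, v` with `v u = p q u v`. -/
theorem columnStep_pow_apply (hq : q ≠ 0) (h : β * α = p • (α * β)) (n : ℕ) (f : ℤ → A)
    (s : ℤ) : (columnStep q α β ^ n) f s = ∑ m ∈ Finset.range (n + 1),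
      (gaussBinom (p * q) n m * q ^ ((s - m) * (n - m : ℕ))) •
        (α ^ m * (β ^ (n - m) * f (s - m))) := by
  let u : Module.End K (ℤ → A) :=
    { toFun f s := α * f (s - 1)
      map_add' f g := by ext s; simp [mul_add]
      map_smul' r f := by ext s; simp }
  let v : Module.End K (ℤ → A) :=
    { toFun f s := q ^ s • (β * f s)
      map_add' f g := by ext s; simp [mul_add]
      map_smul' r f := by ext s; simp [smul_comm r] }
  have hvu : v * u = (p * q) • (u * v) := by
    ext f s
    simp only [u, v, Module.End.mul_apply, LinearMap.coe_mk, AddHom.coe_mk, LinearMap.smul_apply,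
      Pi.smul_apply, mul_smul_comm, ← mul_assoc, h, smul_mul_assoc, smul_smul,
      zpow_sub_one₀ hq]
    congr 1
    field_simp
  have hu (m : ℕ) (f : ℤ → A) (s : ℤ) : (u ^ m) f s = α ^ m * f (s - m) := by
    induction m generalizing s with
    | zero => simp
    | succ m ih =>
      rw [pow_succ', Module.End.mul_apply]
      simp only [u, LinearMap.coe_mk, AddHom.coe_mk] at ih ⊢
      rw [ih, ← mul_assoc, ← pow_succ', sub_sub, Nat.cast_succ, add_comm (1 : ℤ)]
  have hv (m : ℕ) (f : ℤ → A) (s : ℤ) : (v ^ m) f s = q ^ (s * m) • (β ^ m * f s) := by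
    induction m with
    | zero => simp
    | succ m ih =>
      rw [pow_succ', Module.End.mul_apply]
      simp only [v, LinearMap.coe_mk, AddHom.coe_mk] at ih ⊢
      rw [ih, mul_smul_comm, smul_smul, ← mul_assoc, ← pow_succ', ← zpow_add₀ hq,
        Nat.cast_succ, mul_add_one, add_comm s]
  have hsum : columnStep q α β = u + v := rfl
  rw [hsum, gaussBinom_add_pow hvu]
  simp only [LinearMap.sum_apply, Finset.sum_apply, LinearMap.smul_apply, Module.End.mul_apply,
    Pi.smul_apply, hu, hv, mul_smul_comm, smul_smul]

theorem columnStep_apply_eq_zero_of_neg {f : ℤ → A} (hf : ∀ s < 0, f s = 0) :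
    ∀ s < 0, columnStep q α β f s = 0 := fun s hs => by
  rw [columnStep_apply, hf s hs, hf _ (by omega), mul_zero, mul_zero, smul_zero, add_zero]

theorem columnStep_apply_eq_zero_of_gt {N : ℤ} {f : ℤ → A} (hf : ∀ s > N, f s = 0) :
    ∀ s > N + 1, columnStep q α β f s = 0 := fun s hs => by
  rw [columnStep_apply, hf s (by omega), hf _ (by omega), mul_zero, mul_zero, smul_zero, add_zero]

end columnStep

namespace IsQuantumMatrix

variable {K A : Type*} [Field K] [Ring A] [Algebra K A] {p q : K} {a b c d D : A}
  (M : IsQuantumMatrix p q a b c d D)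

include M

theorem columnStep_right_left (hq : q ≠ 0) (f : ℤ → A) :
    columnStep q b d (columnStep q a c f) = q • columnStep q a c (columnStep q b d f) := by
  ext s
  simp only [columnStep_apply, Pi.smul_apply, mul_add, mul_smul_comm, ← mul_assoc, M.ba, M.dc,
    M.ad, M.da, M.cb, add_mul, smul_mul_assoc, zpow_sub_one₀ hq]
  match_scalars <;> field_simp

theorem lowering_left_columnStep_left (hp : p ≠ 0) (hq : q ≠ 0) (N : ℤ) (f : ℤ → A) :
    lowering p q (N + 1) a c (columnStep q a c f) =
      columnStep q (p • a) (q • c) (lowering p q N a c f) := by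
  ext s
  simp only [columnStep_apply, lowering, mul_add, mul_sub, mul_smul_comm, smul_mul_assoc,
    sub_add_cancel, add_sub_cancel_right, ← mul_assoc, M.ca, qInt, mul_zpow, zpow_add₀ hp,
    zpow_add₀ hq, zpow_sub₀ hp, zpow_sub₀ hq, zpow_one]
  match_scalars <;> field_simp
  ring

theorem lowering_right_columnStep_right (hp : p ≠ 0) (hq : q ≠ 0) (N : ℤ) (f : ℤ → A) :
    lowering p q (N + 1) b d (columnStep q b d f) =
      columnStep q (p • b) (q • d) (lowering p q N b d f) := by
  ext s
  simp only [columnStep_apply, lowering, mul_add, mul_sub, mul_smul_comm, smul_mul_assoc,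
    sub_add_cancel, add_sub_cancel_right, ← mul_assoc, M.db, qInt, mul_zpow, zpow_add₀ hp,
    zpow_add₀ hq, zpow_sub₀ hp, zpow_sub₀ hq, zpow_one]
  match_scalars <;> field_simp
  ring

theorem lowering_left_columnStep_right (hp : p ≠ 0) (hq : q ≠ 0) (hx : p * q ≠ 1) (N : ℤ)
    (f : ℤ → A) : lowering p q (N + 1) a c (columnStep q b d f) =
      columnStep q ((p / q) • b) d (lowering p q N a c f) + (p * (p * q) ^ N) • (D • f) := by
  have h1 : 1 - p * q ≠ 0 := sub_ne_zero.2 hx.symm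
  ext s
  simp only [columnStep_apply, lowering, mul_add, mul_sub, mul_smul_comm, smul_mul_assoc,
    sub_add_cancel, add_sub_cancel_right, ← mul_assoc, M.ba, M.dc, M.ad, M.da, M.cb, add_mul,
    Pi.add_apply, Pi.smul_apply, smul_eq_mul, qInt,
    mul_zpow, zpow_add₀ hp, zpow_add₀ hq, zpow_sub₀ hp, zpow_sub₀ hq, zpow_one]
  match_scalars <;> field_simp <;> ring

theorem lowering_right_columnStep_left (hp : p ≠ 0) (hq : q ≠ 0) (hx : p * q ≠ 1) (N : ℤ)
    (f : ℤ → A) : lowering p q (N + 1) b d (columnStep q a c f) =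
      q • columnStep q (p • a) (q • c) (lowering p q N b d f) - D • f := by
  have h1 : 1 - p * q ≠ 0 := sub_ne_zero.2 hx.symm
  ext s
  simp only [columnStep_apply, lowering, mul_add, mul_sub, mul_smul_comm, smul_mul_assoc,
    sub_add_cancel, add_sub_cancel_right, ← mul_assoc, M.ba, M.dc, M.ad, M.da, M.cb, add_mul,
    Pi.sub_apply, Pi.smul_apply, smul_eq_mul, qInt,
    mul_zpow, zpow_add₀ hp, zpow_add₀ hq, zpow_sub₀ hp, zpow_sub₀ hq, zpow_one]
  match_scalars <;> field_simp <;> ring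

theorem columnStep_left_D_smul (hp : p ≠ 0) (hq : q ≠ 0) (f : ℤ → A) :
    columnStep q (p • a) (q • c) (D • f) = p • D • columnStep q a c f := by
  ext s
  simp only [columnStep_apply, Pi.smul_apply, smul_eq_mul, smul_mul_assoc, ← mul_assoc, mul_add,
    mul_smul_comm, M.aD, M.cD]
  match_scalars <;> field_simp

theorem columnStep_right_D_smul (hp : p ≠ 0) (hq : q ≠ 0) (f : ℤ → A) :
    columnStep q ((p / q) • b) d (D • f) = D • columnStep q b d f := by
  ext s
  simp only [columnStep_apply, Pi.smul_apply, smul_eq_mul, smul_mul_assoc, ← mul_assoc, mul_add,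
    mul_smul_comm, M.bD, M.dD]
  match_scalars <;> field_simp

end IsQuantumMatrix

section columnCoeff

variable {K A : Type*} [Field K] [Ring A] [Algebra K A]

/-- The coefficient of `x^s y^{P+R-s}` in `(x a + y c)^P (x b + y d)^R`, where `y x = q x y`. Up to
normalisation these are the matrix coefficients `t^ℓ_{i,j}` of spin `ℓ = (P + R) / 2`, with
`P = ℓ - j`, `R = ℓ + j` and `s = ℓ - i`. -/
def columnCoeff (q : K) (a b c d : A) (P R : ℕ) : ℤ → A :=
  (columnStep q a c ^ P) ((columnStep q b d ^ R) (Pi.single 0 1))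

variable {q : K} {a b c d : A}

theorem columnCoeff_zero_zero : columnCoeff q a b c d 0 0 = Pi.single 0 1 := rfl

theorem columnCoeff_succ_left (P R : ℕ) :
    columnCoeff q a b c d (P + 1) R = columnStep q a c (columnCoeff q a b c d P R) := by
  rw [columnCoeff, pow_succ', Module.End.mul_apply, columnCoeff]

theorem columnCoeff_zero_succ (R : ℕ) :
    columnCoeff q a b c d 0 (R + 1) = columnStep q b d (columnCoeff q a b c d 0 R) := by
  rw [columnCoeff, pow_zero, pow_succ', Module.End.mul_apply, Module.End.one_apply,
    columnCoeff, pow_zero, Module.End.one_apply]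

theorem columnCoeff_of_neg (P R : ℕ) : ∀ s < 0, columnCoeff q a b c d P R s = 0 := by
  induction P with
  | zero =>
    induction R with
    | zero => exact fun s hs => Pi.single_eq_of_ne hs.ne 1
    | succ R ih =>
      rw [columnCoeff_zero_succ]
      exact columnStep_apply_eq_zero_of_neg ih
  | succ P ih =>
    rw [columnCoeff_succ_left]
    exact columnStep_apply_eq_zero_of_neg ih

theorem columnCoeff_of_gt (P R : ℕ) :
    ∀ s > (P + R : ℤ), columnCoeff q a b c d P R s = 0 := by
  induction P with
  | zero =>
    induction R with
    | zero => exact fun s hs => Pi.single_eq_of_ne (by simpa using hs.ne') 1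
    | succ R ih =>
      rw [columnCoeff_zero_succ, Nat.cast_succ, ← add_assoc]
      exact columnStep_apply_eq_zero_of_gt ih
  | succ P ih =>
    rw [columnCoeff_succ_left, Nat.cast_succ, add_right_comm]
    exact columnStep_apply_eq_zero_of_gt ih

end columnCoeff

namespace IsQuantumMatrix

variable {K A : Type*} [Field K] [Ring A] [Algebra K A] {p q : K} {a b c d D : A}
  (M : IsQuantumMatrix p q a b c d D)

include M

theorem columnCoeff_succ_right (hq : q ≠ 0) (P R : ℕ) :
    columnStep q b d (columnCoeff q a b c d P R) = q ^ P • columnCoeff q a b c d P (R + 1) := by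
  induction P with
  | zero => rw [pow_zero, one_smul, columnCoeff_zero_succ]
  | succ P ih =>
    rw [columnCoeff_succ_left, M.columnStep_right_left hq, ih, map_smul, smul_smul, ← pow_succ',
      columnCoeff_succ_left]

theorem lowering_left_columnCoeff_zero (hp : p ≠ 0) (hq : q ≠ 0) (hx : p * q ≠ 1) (R : ℕ) :
    lowering p q R a c (columnCoeff q a b c d 0 R) =
      (p * qInt (p * q) R) • D • columnCoeff q a b c d 0 (R - 1) := by
  induction R with
  | zero => rw [Nat.cast_zero, columnCoeff_zero_zero, lowering_single_zero, qInt_zero, mul_zero,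
      zero_smul]
  | succ R ih =>
    have hprev : qInt (p * q) R • columnStep q b d (columnCoeff q a b c d 0 (R - 1)) =
        qInt (p * q) R • columnCoeff q a b c d 0 R := by
      rcases R with _ | R
      · rw [Nat.cast_zero, qInt_zero, zero_smul, zero_smul]
      · rw [columnCoeff_zero_succ, Nat.add_sub_cancel]
    rw [columnCoeff_zero_succ, Nat.cast_succ, M.lowering_left_columnStep_right hp hq hx, ih,
      map_smul, M.columnStep_right_D_smul hp hq, mul_smul, smul_comm _ D, hprev,
      ← smul_comm _ D, smul_smul, ← add_smul, ← mul_add, Nat.add_sub_cancel,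
      ← qInt_add_one (mul_ne_zero hp hq) hx]

theorem lowering_left_columnCoeff (hp : p ≠ 0) (hq : q ≠ 0) (hx : p * q ≠ 1) (P R : ℕ) :
    lowering p q (P + R) a c (columnCoeff q a b c d P R) =
      (p ^ (P + 1) * qInt (p * q) R) • D • columnCoeff q a b c d P (R - 1) := by
  induction P with
  | zero =>
    rw [Nat.cast_zero, zero_add, zero_add, pow_one, M.lowering_left_columnCoeff_zero hp hq hx]
  | succ P ih =>
    rw [columnCoeff_succ_left, Nat.cast_succ, add_right_comm,
      M.lowering_left_columnStep_left hp hq, ih, map_smul, M.columnStep_left_D_smul hp hq,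
      columnCoeff_succ_left, smul_smul, mul_right_comm, ← pow_succ]

theorem lowering_right_columnCoeff_zero (hp : p ≠ 0) (hq : q ≠ 0) (R : ℕ) :
    lowering p q R b d (columnCoeff q a b c d 0 R) = 0 := by
  induction R with
  | zero => exact lowering_single_zero
  | succ R ih =>
    rw [columnCoeff_zero_succ, Nat.cast_succ, M.lowering_right_columnStep_right hp hq, ih, map_zero]

theorem lowering_right_columnCoeff (hp : p ≠ 0) (hq : q ≠ 0) (hx : p * q ≠ 1) (P R : ℕ) :
    lowering p q (P + R) b d (columnCoeff q a b c d P R) =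
      -qInt (p * q) P • D • columnCoeff q a b c d (P - 1) R := by
  induction P with
  | zero =>
    rw [Nat.cast_zero, zero_add, M.lowering_right_columnCoeff_zero hp hq, qInt_zero, neg_zero,
      zero_smul]
  | succ P ih =>
    have hprev : qInt (p * q) P • columnStep q a c (columnCoeff q a b c d (P - 1) R) =
        qInt (p * q) P • columnCoeff q a b c d P R := by
      rcases P with _ | P
      · rw [Nat.cast_zero, qInt_zero, zero_smul, zero_smul]
      · rw [columnCoeff_succ_left, Nat.add_sub_cancel]
    rw [columnCoeff_succ_left, Nat.cast_succ, add_right_comm,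
      M.lowering_right_columnStep_left hp hq hx, ih, map_smul, M.columnStep_left_D_smul hp hq,
      neg_smul, smul_comm _ p, smul_comm _ D, hprev, ← smul_comm _ D, smul_neg, smul_smul,
      smul_smul, ← neg_add', ← one_smul K (D • _), smul_smul, mul_one, ← add_smul,
      Nat.add_sub_cancel, neg_smul, add_comm (P : ℤ), qInt_add (mul_ne_zero hp hq), zpow_one,
      qInt_one hx, add_comm, mul_comm q]

theorem a_mul_columnCoeff (hp : p ≠ 0) (hq : q ≠ 0) (hx : p * q ≠ 1) (P R : ℕ) (s : ℤ) :
    qInt (p * q) (P + R + 1) • (a * columnCoeff q a b c d P R s) =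
      qInt (p * q) (s + 1) • columnCoeff q a b c d (P + 1) R (s + 1) +
        (q ^ (s + 1) * p ^ (P + 1) * qInt (p * q) R) •
          (D * columnCoeff q a b c d P (R - 1) s) := by
  rw [qInt_smul_mul_left (mul_ne_zero hp hq), M.lowering_left_columnCoeff hp hq hx,
    columnCoeff_succ_left, Pi.smul_apply, smul_smul, ← mul_assoc]
  rfl

theorem c_mul_columnCoeff (hp : p ≠ 0) (hq : q ≠ 0) (hx : p * q ≠ 1) (P R : ℕ) (s : ℤ) :
    qInt (p * q) (P + R + 1) • (c * columnCoeff q a b c d P R (s + 1)) =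
      (p ^ (s + 1) * qInt (p * q) (P + R - s)) • columnCoeff q a b c d (P + 1) R (s + 1) -
        (p ^ (P + 1) * qInt (p * q) R) • (D * columnCoeff q a b c d P (R - 1) s) := by
  rw [qInt_smul_mul_right (mul_ne_zero hp hq), M.lowering_left_columnCoeff hp hq hx,
    columnCoeff_succ_left]
  rfl

theorem b_mul_columnCoeff (hp : p ≠ 0) (hq : q ≠ 0) (hx : p * q ≠ 1) (P R : ℕ) (s : ℤ) :
    qInt (p * q) (P + R + 1) • (b * columnCoeff q a b c d P R s) =
      (q ^ P * qInt (p * q) (s + 1)) • columnCoeff q a b c d P (R + 1) (s + 1) -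
        (q ^ (s + 1) * qInt (p * q) P) • (D * columnCoeff q a b c d (P - 1) R s) := by
  rw [qInt_smul_mul_left (mul_ne_zero hp hq), M.lowering_right_columnCoeff hp hq hx,
    M.columnCoeff_succ_right hq, Pi.smul_apply, Pi.smul_apply, smul_smul, smul_smul,
    mul_neg, neg_smul, ← sub_eq_add_neg, mul_comm (q ^ P)]
  rfl

theorem d_mul_columnCoeff (hp : p ≠ 0) (hq : q ≠ 0) (hx : p * q ≠ 1) (P R : ℕ) (s : ℤ) :
    qInt (p * q) (P + R + 1) • (d * columnCoeff q a b c d P R (s + 1)) =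
      (q ^ P * p ^ (s + 1) * qInt (p * q) (P + R - s)) •
          columnCoeff q a b c d P (R + 1) (s + 1) +
        qInt (p * q) P • (D * columnCoeff q a b c d (P - 1) R s) := by
  rw [qInt_smul_mul_right (mul_ne_zero hp hq), M.lowering_right_columnCoeff hp hq hx,
    M.columnCoeff_succ_right hq, Pi.smul_apply, Pi.smul_apply, smul_smul, neg_smul,
    sub_neg_eq_add, mul_comm (_ * qInt _ _), mul_assoc (q ^ P)]
  rfl

theorem columnCoeff_mul_D (hp : p ≠ 0) (hq : q ≠ 0) (P R : ℕ) (s : ℤ) :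
    columnCoeff q a b c d P R s * D =
      (q / p) ^ (s - P) • (D * columnCoeff q a b c d P R s) := by
  have hqp : q / p ≠ 0 := div_ne_zero hq hp
  induction P generalizing s with
  | zero =>
    induction R generalizing s with
    | zero => rcases eq_or_ne s 0 with rfl | hs <;> simp [columnCoeff_zero_zero, *]
    | succ R ih =>
      simp only [columnCoeff_zero_succ, columnStep_apply, add_mul, smul_mul_assoc, mul_assoc, ih]
      simp only [mul_smul_comm, ← mul_assoc, M.bD, M.dD, mul_add, smul_mul_assoc]
      rw [Nat.cast_zero, sub_zero, sub_zero, zpow_sub_one₀ hqp]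
      match_scalars <;> field_simp
  | succ P ih =>
    simp only [columnCoeff_succ_left, columnStep_apply, add_mul, smul_mul_assoc, mul_assoc, ih]
    simp only [mul_smul_comm, ← mul_assoc, M.aD, M.cD, mul_add, smul_mul_assoc]
    rw [Nat.cast_succ, sub_sub s 1, add_comm 1, ← sub_sub, zpow_sub_one₀ hqp]
    match_scalars <;> field_simp

theorem columnCoeff_zero_apply (hq : q ≠ 0) (R n : ℕ) : columnCoeff q a b c d 0 R n =
    gaussBinom (p * q) R n • (b ^ n * d ^ (R - n)) := by
  rw [columnCoeff, pow_zero, Module.End.one_apply, columnStep_pow_apply hq M.db]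
  rcases le_or_gt n R with hn | hn
  · rw [Finset.sum_eq_single_of_mem n (by simpa using hn)]
    · simp
    · intro m _ hm
      rw [Pi.single_eq_of_ne (by simpa [sub_eq_zero] using Ne.symm hm), mul_zero, mul_zero,
        smul_zero]
  · rw [gaussBinom_of_lt _ hn, zero_smul]
    refine Finset.sum_eq_zero fun m hm => ?_
    have hm' : (n : ℤ) - m ≠ 0 := by have := Finset.mem_range_succ_iff.1 hm; omega
    rw [Pi.single_eq_of_ne hm', mul_zero, mul_zero, smul_zero]

theorem columnCoeff_apply (hq : q ≠ 0) (P R n : ℕ) : columnCoeff q a b c d P R n =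
    ∑ ij ∈ Finset.HasAntidiagonal.antidiagonal n with ij.1 ≤ P ∧ ij.2 ≤ R,
      (q ^ (ij.2 * (P - ij.1)) * gaussBinom (p * q) P ij.1 * gaussBinom (p * q) R ij.2) •
        (a ^ ij.1 * c ^ (P - ij.1) * b ^ ij.2 * d ^ (R - ij.2)) := by
  have hright : ⇑(columnStep q b d ^ R) (Pi.single 0 1) = columnCoeff q a b c d 0 R := rfl
  rw [columnCoeff, columnStep_pow_apply hq M.ca, hright, Finset.sum_filter_of_ne,
    Finset.Nat.sum_antidiagonal_eq_sum_range_succ_mk]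
  · refine Finset.sum_congr_of_eq_on_inter (fun m _ hm => ?_) (fun m _ hm => ?_) fun m _ hm => ?_
    · have hneg : (n : ℤ) - m < 0 := by simp only [Finset.mem_range_succ_iff] at hm; omega
      rw [columnCoeff_of_neg _ _ _ hneg, mul_zero, mul_zero, smul_zero]
    · rw [gaussBinom_of_lt (k := m) _ (by simpa using hm), mul_zero, zero_mul, zero_smul]
    · rw [← Nat.cast_sub (Finset.mem_range_succ_iff.1 hm), M.columnCoeff_zero_apply hq,
        ← Nat.cast_mul, zpow_natCast]
      simp only [mul_smul_comm, smul_smul, mul_assoc]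
      rw [mul_left_comm]
  · intro ij _ hne
    by_contra! hout
    refine hne ?_
    rcases lt_or_ge P ij.1 with h | h
    · rw [gaussBinom_of_lt _ h, mul_zero, zero_mul, zero_smul]
    · rw [gaussBinom_of_lt _ (hout h), mul_zero, zero_smul]

end IsQuantumMatrix

/-! ## Normalisation constants -/

section realScalars

variable {x : ℝ}

theorem qInt_natCast_pos (hx0 : 0 ≤ x) (hx1 : x < 1) {n : ℕ} (hn : n ≠ 0) : 0 < qInt x n := by
  rw [qInt, zpow_natCast]
  exact div_pos (sub_pos.2 (pow_lt_one₀ hx0 hx1 hn)) (sub_pos.2 hx1)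

theorem qFactorial_zero (x : ℝ) : qFactorial x 0 = 1 := Finset.prod_range_zero _

theorem qFactorial_succ (x : ℝ) (n : ℕ) :
    qFactorial x (n + 1) = qInt x (n + 1) * qFactorial x n := by
  rw [qFactorial, Finset.prod_range_succ, mul_comm, qFactorial, qInt]
  norm_cast

theorem qFactorial_pos (hx0 : 0 ≤ x) (hx1 : x < 1) (n : ℕ) : 0 < qFactorial x n := by
  induction n with
  | zero => rw [qFactorial_zero]; exact one_pos
  | succ n ih =>
    rw [qFactorial_succ]
    exact mul_pos (mod_cast qInt_natCast_pos hx0 hx1 n.succ_ne_zero) ih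

theorem gaussBinom_mul_qFactorial (hx : x ≠ 0) {n k : ℕ} (hk : k ≤ n) :
    gaussBinom x n k * (qFactorial x k * qFactorial x (n - k)) = qFactorial x n := by
  induction n generalizing k with
  | zero => obtain rfl := Nat.le_zero.1 hk; simp [qFactorial_zero]
  | succ n ih =>
    rcases k with _ | k
    · simp [qFactorial_zero]
    have hk' : k ≤ n := Nat.le_of_succ_le_succ hk
    have hleft : gaussBinom x n k * (qFactorial x (k + 1) * qFactorial x (n - k)) =
        qInt x (k + 1) * qFactorial x n := by
      rw [← ih hk', qFactorial_succ]
      ring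
    have hright : gaussBinom x n (k + 1) * (qFactorial x (k + 1) * qFactorial x (n - k)) =
        qInt x (n - k) * qFactorial x n := by
      rcases hk'.eq_or_lt with rfl | hlt
      · simp [gaussBinom_of_lt]
      · obtain ⟨m, rfl⟩ := Nat.exists_eq_add_of_lt hlt
        have := ih (k := k + 1) (by omega)
        rw [← this, show k + m + 1 - k = m + 1 by omega, qFactorial_succ x m,
          show k + m + 1 - (k + 1) = m by omega, show ((k + m + 1 : ℕ) : ℤ) - k = m + 1 by omega]
        ring
    rw [gaussBinom_succ_succ, Nat.add_sub_add_right, add_mul, mul_assoc, hleft, hright,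
      qFactorial_succ, show (n : ℤ) + 1 = k + 1 + (n - k) by ring, qInt_add hx (k + 1)]
    norm_cast
    ring

theorem gaussBinom_eq_qBinomial (hx0 : 0 < x) (hx1 : x < 1) {n k : ℕ} (hk : k ≤ n) :
    gaussBinom x n k = qBinomial x n k := by
  have hF (m : ℕ) : qFactorial x m ≠ 0 := (qFactorial_pos hx0.le hx1 m).ne'
  rw [qBinomial, eq_div_iff (mul_ne_zero (hF _) (hF _)), gaussBinom_mul_qFactorial hx0.ne' hk]

/-- The normalisation of `columnCoeff` in row `(s, M) = (ℓ - i, ℓ + i)` and column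
`(P, R) = (ℓ - j, ℓ + j)`, up to a power of `x`. -/
def normConst (x : ℝ) (P R s M : ℕ) : ℝ :=
  √(qInt x (P + R + 1) * (qFactorial x s * qFactorial x M) / (qFactorial x P * qFactorial x R))

theorem normConst_comm_left (x : ℝ) (P R s M : ℕ) :
    normConst x P R s M = normConst x R P s M := by
  rw [normConst, normConst, add_comm (P : ℤ), mul_comm (qFactorial x P)]

theorem normConst_comm_right (x : ℝ) (P R s M : ℕ) :
    normConst x P R s M = normConst x P R M s := by
  rw [normConst, normConst, mul_comm (qFactorial x s)]

/-- The square root in the coefficients of the action, `√([u] [v] / ([n] [n + 1]))`. -/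
def ladderRoot (x : ℝ) (u v n : ℤ) : ℝ := √(qInt x u * qInt x v / (qInt x n * qInt x (n + 1)))

theorem mul_sqrt_eq_mul_sqrt_mul_sqrt {m n y z w : ℝ} (hm : 0 ≤ m) (hn : 0 ≤ n) (hz : 0 ≤ z)
    (h : m ^ 2 * y = n ^ 2 * (z * w)) : m * √y = n * (√z * √w) := by
  rw [← Real.sqrt_mul hz, ← Real.sqrt_sq hm, ← Real.sqrt_mul (sq_nonneg m), h,
    Real.sqrt_mul (sq_nonneg n), Real.sqrt_sq hn]

theorem qInt_mul_normConst_raise (hx0 : 0 ≤ x) (hx1 : x < 1) (P R s M : ℕ) :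
    qInt x (s + 1) * normConst x P R s M = qInt x (P + R + 1) *
      (ladderRoot x (P + 1) (s + 1) (P + R + 1) * normConst x (P + 1) R (s + 1) M) := by
  have hF (n : ℕ) : 0 < qFactorial x n := qFactorial_pos hx0 hx1 n
  have hN (n : ℕ) : 0 < qInt x (n + 1) := mod_cast qInt_natCast_pos hx0 hx1 n.succ_ne_zero
  have hP := hF P
  have hR := hF R
  have hP1 := hN P
  have hs1 := hN s
  have hN1 : 0 < qInt x (P + R + 1) := mod_cast hN (P + R)
  have hN2 : 0 < qInt x (P + R + 1 + 1) := mod_cast hN (P + R + 1)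
  refine mul_sqrt_eq_mul_sqrt_mul_sqrt hs1.le hN1.le (by positivity) ?_
  rw [qFactorial_succ, qFactorial_succ, Nat.cast_succ, add_right_comm (P : ℤ) 1]
  field_simp

theorem qInt_mul_normConst_lower (hx0 : 0 ≤ x) (hx1 : x < 1) (P R s M : ℕ) :
    qInt x (R + 1) * normConst x P (R + 1) s (M + 1) = qInt x (P + R + 1 + 1) *
      (ladderRoot x (R + 1) (M + 1) (P + R + 1) * normConst x P R s M) := by
  have hF (n : ℕ) : 0 < qFactorial x n := qFactorial_pos hx0 hx1 n
  have hN (n : ℕ) : 0 < qInt x (n + 1) := mod_cast qInt_natCast_pos hx0 hx1 n.succ_ne_zero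
  have hP := hF P
  have hR := hF R
  have hR1 := hN R
  have hM1 := hN M
  have hN1 : 0 < qInt x (P + R + 1) := mod_cast hN (P + R)
  have hN2 : 0 < qInt x (P + R + 1 + 1) := mod_cast hN (P + R + 1)
  refine mul_sqrt_eq_mul_sqrt_mul_sqrt hR1.le hN2.le (by positivity) ?_
  rw [qFactorial_succ, qFactorial_succ, Nat.cast_succ, ← add_assoc]
  field_simp

end realScalars

/-! ## The action on the matrix coefficients -/

section generators

variable {q : ℂ}

/-- The element `c = -q̄ D b*` of `O(U_q(2))`. -/
def polyC (q : ℂ) : Poly q := (-conj q) • (g q .D * g q .bs)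

/-- The element `d = D a*` of `O(U_q(2))`. -/
def polyD (q : ℂ) : Poly q := g q .D * g q .as

theorem g_as_eq : g q .as = g q .Ds * polyD q := by
  rw [polyD, assoc_of q (g_Ds_D q), one_mul]

theorem g_bs_eq (hq : q ≠ 0) : g q .bs = (-(conj q)⁻¹) • (g q .Ds * polyC q) := by
  rw [polyC, mul_smul_comm, assoc_of q (g_Ds_D q), one_mul, smul_smul, neg_mul_neg,
    inv_mul_cancel₀ ((map_ne_zero _).2 hq), one_smul]

theorem isQuantumMatrix (hq : q ≠ 0) :
    IsQuantumMatrix (conj q) q (g q .a) (g q .b) (polyC q) (polyD q) (g q .D) := by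
  have hp : conj q ≠ 0 := (map_ne_zero _).2 hq
  constructor <;>
    simp only [polyC, polyD, smul_mul_assoc, mul_smul_comm, mul_assoc, g_ba, g_bs_a, g_as_b,
      g_as_bs, g_bs_b, g_a_as, g_as_a, g_aD, g_bD, g_bsD, g_asD, assoc_of q (g_aD q),
      assoc_of q (g_bD q), assoc_of q (g_bsD q), assoc_of q (g_asD q), mul_add, mul_one,
      norm_sq_eq] <;>
    match_scalars <;> field_simp

theorem conj_mul_self_eq (q : ℂ) : conj q * q = ((‖q‖ ^ 2 : ℝ) : ℂ) := by
  rw [Complex.conj_mul', Complex.ofReal_pow]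

theorem norm_sq_lt_one (hq1 : ‖q‖ < 1) : ‖q‖ ^ 2 < 1 := pow_lt_one₀ (norm_nonneg q) hq1 two_ne_zero

theorem conj_mul_self_ne_one (hq1 : ‖q‖ < 1) : conj q * q ≠ 1 := by
  rw [conj_mul_self_eq]
  exact_mod_cast (norm_sq_lt_one hq1).ne

theorem qInt_conj_mul_self (q : ℂ) (n : ℤ) : qInt (conj q * q) n = (qInt (‖q‖ ^ 2) n : ℝ) := by
  rw [conj_mul_self_eq]
  exact (map_qInt Complex.ofRealHom _ n).symm

theorem gaussBinom_conj_mul_self (q : ℂ) (n k : ℕ) :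
    gaussBinom (conj q * q) n k = (gaussBinom (‖q‖ ^ 2) n k : ℝ) := by
  rw [conj_mul_self_eq]
  exact (map_gaussBinom _ Complex.ofRealHom n k).symm

theorem qInt_conj_mul_self_ne_zero (hq1 : ‖q‖ < 1) (n : ℕ) :
    qInt (conj q * q) (n + 1) ≠ 0 := by
  rw [qInt_conj_mul_self, Complex.ofReal_ne_zero]
  exact_mod_cast (qInt_natCast_pos (sq_nonneg ‖q‖) (norm_sq_lt_one hq1) n.succ_ne_zero).ne'

end generators

section unitPow

theorem zpow_mul_eq_smul {K A : Type*} [Field K] [Ring A] [Algebra K A] {u : Aˣ} {y : A} {c : K}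
    (hc : c ≠ 0) (h : y * u = c • (u * y)) (n : ℤ) :
    ((u ^ n : Aˣ) : A) * y = c ^ (-n) • (y * ((u ^ n : Aˣ) : A)) := by
  have hu : (u : A) * y = c⁻¹ • (y * u) := by rw [h, smul_smul, inv_mul_cancel₀ hc, one_smul]
  have hinv : ((u⁻¹ : Aˣ) : A) * y = c • (y * ((u⁻¹ : Aˣ) : A)) := by
    rw [Units.inv_mul_eq_iff_eq_mul, mul_smul_comm, ← mul_assoc, ← smul_mul_assoc, ← h,
      Units.mul_inv_cancel_right]
  induction n with
  | zero => simp
  | succ n ih =>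
    rw [add_comm, zpow_one_add, Units.val_mul, mul_assoc, ih, mul_smul_comm, ← mul_assoc, hu,
      smul_mul_assoc, smul_smul, mul_assoc, neg_add_rev, zpow_add₀ hc, zpow_neg_one]
  | pred n ih =>
    rw [sub_eq_neg_add, zpow_add, zpow_neg_one, Units.val_mul, mul_assoc, ih, mul_smul_comm,
      ← mul_assoc, hinv, smul_mul_assoc, smul_smul, mul_assoc, neg_add_rev, neg_neg, neg_neg,
      zpow_add_one₀ hc]

variable {q : ℂ}

/-- The unit `D` of `O(U_q(2))`. -/
def dUnit (q : ℂ) : (Poly q)ˣ := ⟨g q .D, g q .Ds, g_D_Ds q, g_Ds_D q⟩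

/-- The element `(D*)^k = D^{-k}` of `O(U_q(2))`. -/
def dPow (q : ℂ) (k : ℤ) : Poly q := ((dUnit q ^ (-k) : (Poly q)ˣ) : Poly q)

theorem dPow_zero : dPow q 0 = 1 := by simp [dPow]

theorem dPow_add (j k : ℤ) : dPow q (j + k) = dPow q j * dPow q k := by
  rw [dPow, neg_add, zpow_add, Units.val_mul, dPow, dPow]

theorem dPow_one : dPow q 1 = g q .Ds := by rw [dPow, zpow_neg_one]; rfl

theorem dPow_neg_one : dPow q (-1) = g q .D := by rw [dPow, neg_neg, zpow_one]; rfl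

theorem toC_g (x : Letter) : toC q (g q x) = toCLetter q x := by simp [toC, g]

theorem toC_polyC : toC q (polyC q) = cElem q := by
  rw [polyC, map_smul, map_mul, toC_g, toC_g]; rfl

theorem toC_polyD : toC q (polyD q) = dElem q := by
  rw [polyD, map_mul, toC_g, toC_g]; rfl

theorem toC_dPow_natCast (n : ℕ) : toC q (dPow q n) = star (gD q) ^ n := by
  rw [dPow, zpow_neg, zpow_natCast, ← inv_pow, Units.val_pow_eq_pow_val, map_pow]
  exact congrArg (· ^ n) (toC_g .Ds)

theorem toC_dPow_neg_natCast (n : ℕ) : toC q (dPow q (-n)) = gD q ^ n := by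
  rw [dPow, neg_neg, zpow_natCast, Units.val_pow_eq_pow_val, map_pow]
  exact congrArg (· ^ n) (toC_g .D)

theorem toC_dPow (k : ℤ) : toC q (dPow q k) = dStarPow q k := by
  obtain ⟨n, rfl | rfl⟩ := k.eq_nat_or_neg
  · rw [toC_dPow_natCast, dStarPow, if_pos n.cast_nonneg, Int.toNat_natCast]
  · rw [toC_dPow_neg_natCast, dStarPow]
    rcases n.eq_zero_or_pos with rfl | hn
    · simp
    · rw [if_neg (by omega), neg_neg, Int.toNat_natCast]

theorem star_toC_dPow (k : ℤ) : star (toC q (dPow q k)) = toC q (dPow q (-k)) := by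
  obtain ⟨n, rfl | rfl⟩ := k.eq_nat_or_neg
  · rw [toC_dPow_natCast, toC_dPow_neg_natCast, star_pow, star_star]
  · rw [neg_neg, toC_dPow_natCast, toC_dPow_neg_natCast, star_pow]

end unitPow

section coeffElem

variable {q : ℂ}

/-- The unnormalised matrix coefficients of `O(U_q(2))`, with the indexing of `columnCoeff`. -/
abbrev polyCoeff (q : ℂ) : ℕ → ℕ → ℤ → Poly q :=
  columnCoeff q (g q .a) (g q .b) (polyC q) (polyD q)

theorem dPow_mul_polyCoeff (hq : q ≠ 0) (j : ℤ) (P R : ℕ) (s : ℤ) :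
    dPow q j * polyCoeff q P R s =
      (q / conj q) ^ ((s - P) * j) • (polyCoeff q P R s * dPow q j) := by
  have hp : conj q ≠ 0 := (map_ne_zero _).2 hq
  rw [dPow, zpow_mul_eq_smul (zpow_ne_zero _ (div_ne_zero hq hp))
    ((isQuantumMatrix hq).columnCoeff_mul_D hp hq P R s), neg_neg, zpow_mul]

/-- The element `t (D*)^k` of `C(U_q(2))` for the unnormalised matrix coefficient `t` with row `s`
and column `(P, R)`; it is `0` if `P` or `R` is negative. -/
def coeffElem (q : ℂ) (P R s k : ℤ) : CUq2 q :=
  if 0 ≤ P ∧ 0 ≤ R then toC q (polyCoeff q P.toNat R.toNat s * dPow q k) else 0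

theorem coeffElem_natCast (P R : ℕ) (s k : ℤ) :
    coeffElem q P R s k = toC q (polyCoeff q P R s * dPow q k) := by
  rw [coeffElem, if_pos ⟨P.cast_nonneg, R.cast_nonneg⟩, Int.toNat_natCast, Int.toNat_natCast]

theorem coeffElem_eq_zero {P R s k : ℤ} (h : P < 0 ∨ R < 0 ∨ s < 0 ∨ P + R < s) :
    coeffElem q P R s k = 0 := by
  rw [coeffElem]
  split_ifs with hPR
  · obtain ⟨hP, hR⟩ := hPR
    have hcoeff : polyCoeff q P.toNat R.toNat s = 0 := by
      rcases lt_or_ge s 0 with hs | hs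
      · exact columnCoeff_of_neg _ _ s hs
      · exact columnCoeff_of_gt _ _ s (by omega)
    rw [hcoeff, zero_mul, map_zero]
  · rfl

theorem toC_dPow_mul_coeffElem (hq : q ≠ 0) (j P R s k : ℤ) :
    toC q (dPow q j) * coeffElem q P R s k =
      (q / conj q) ^ ((s - P) * j) • coeffElem q P R s (k + j) := by
  rw [coeffElem, coeffElem]
  split_ifs with hPR
  · rw [← map_mul, ← mul_assoc, dPow_mul_polyCoeff hq, smul_mul_assoc, mul_assoc, ← dPow_add,
      map_smul, Int.toNat_of_nonneg hPR.1, add_comm j]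
  · rw [mul_zero, smul_zero]

theorem gD_mul_coeffElem (hq : q ≠ 0) (P R s k : ℤ) : gD q * coeffElem q P R s k =
    (q / conj q) ^ (P - s) • coeffElem q P R s (k - 1) := by
  rw [show gD q = toC q (dPow q (-1)) by rw [dPow_neg_one, toC_g]; rfl,
    toC_dPow_mul_coeffElem hq, mul_neg_one, neg_sub, sub_eq_add_neg k]

theorem star_gD_mul_coeffElem (hq : q ≠ 0) (P R s k : ℤ) : star (gD q) * coeffElem q P R s k =
    (q / conj q) ^ (s - P) • coeffElem q P R s (k + 1) := by
  rw [show star (gD q) = toC q (dPow q 1) by rw [dPow_one, toC_g]; rfl,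
    toC_dPow_mul_coeffElem hq, mul_one]

end coeffElem

section coeffElemAction

variable {q : ℂ}

theorem toC_mul_dPow (P R : ℕ) (s k : ℤ) :
    toC q (polyCoeff q P R s * dPow q k) = coeffElem q P R s k := (coeffElem_natCast P R s k).symm

theorem toC_mul_mul_dPow (y : Poly q) (P R : ℕ) (s k : ℤ) :
    toC q (y * polyCoeff q P R s * dPow q k) = toC q y * coeffElem q P R s k := by
  rw [mul_assoc, map_mul, toC_mul_dPow]

theorem mul_qInt_smul_coeffElem_pred_left (c x : ℂ) (P R : ℕ) (s k : ℤ) :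
    (c * qInt x P) • coeffElem q (P - 1 : ℕ) R s k =
      (c * qInt x P) • coeffElem q (P - 1) R s k := by
  rcases P with _ | P
  · rw [Nat.cast_zero, qInt_zero, mul_zero, zero_smul, zero_smul]
  · rw [Nat.add_sub_cancel, Nat.cast_succ, add_sub_cancel_right]

theorem mul_qInt_smul_coeffElem_pred_right (c x : ℂ) (P R : ℕ) (s k : ℤ) :
    (c * qInt x R) • coeffElem q P (R - 1 : ℕ) s k =
      (c * qInt x R) • coeffElem q P (R - 1) s k := by
  rcases R with _ | R
  · rw [Nat.cast_zero, qInt_zero, mul_zero, zero_smul, zero_smul]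
  · rw [Nat.add_sub_cancel, Nat.cast_succ, add_sub_cancel_right]

theorem gA_mul_coeffElem (hq : q ≠ 0) (hq1 : ‖q‖ < 1) (P R : ℕ) (s k : ℤ) :
    qInt (conj q * q) (P + R + 1) • (gA q * coeffElem q P R s k) =
      qInt (conj q * q) (s + 1) • coeffElem q (P + 1) R (s + 1) k +
        (q ^ (P + 1) * conj q ^ (s + 1) * qInt (conj q * q) R) •
          coeffElem q P (R - 1) s (k - 1) := by
  have hp : conj q ≠ 0 := (map_ne_zero _).2 hq
  have hrec := congrArg (fun y => toC q (y * dPow q k))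
    ((isQuantumMatrix hq).a_mul_columnCoeff hp hq (conj_mul_self_ne_one hq1) P R s)
  simp only [add_mul, smul_mul_assoc, map_add, map_smul, toC_mul_mul_dPow, toC_mul_dPow, toC_g,
    toCLetter] at hrec
  rw [hrec, gD_mul_coeffElem hq, smul_comm, mul_qInt_smul_coeffElem_pred_right, smul_smul,
    Nat.cast_succ]
  congr 2
  simp only [zpow_add_one₀ hp, zpow_add_one₀ hq, zpow_sub₀ (div_ne_zero hq hp), div_zpow, div_pow,
    zpow_natCast, pow_succ]
  field_simp

theorem gB_mul_coeffElem (hq : q ≠ 0) (hq1 : ‖q‖ < 1) (P R : ℕ) (s k : ℤ) :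
    qInt (conj q * q) (P + R + 1) • (gB q * coeffElem q P R s k) =
      (q ^ P * qInt (conj q * q) (s + 1)) • coeffElem q P (R + 1) (s + 1) k -
        (q ^ P * conj q ^ (s - P + 1) * qInt (conj q * q) P) •
          coeffElem q (P - 1) R s (k - 1) := by
  have hp : conj q ≠ 0 := (map_ne_zero _).2 hq
  have hrec := congrArg (fun y => toC q (y * dPow q k))
    ((isQuantumMatrix hq).b_mul_columnCoeff hp hq (conj_mul_self_ne_one hq1) P R s)
  simp only [sub_mul, smul_mul_assoc, map_sub, map_smul, toC_mul_mul_dPow, toC_mul_dPow, toC_g,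
    toCLetter] at hrec
  rw [hrec, ← mul_smul_comm, mul_qInt_smul_coeffElem_pred_left, mul_smul_comm,
    gD_mul_coeffElem hq, smul_smul, Nat.cast_succ]
  congr 2
  simp only [zpow_add_one₀ hp, zpow_sub_one₀ (div_ne_zero hq hp), zpow_add_one₀ hq, zpow_sub₀ hp,
    zpow_sub₀ (div_ne_zero hq hp), div_zpow, div_pow, zpow_natCast]
  field_simp

theorem star_gA_mul_coeffElem (hq : q ≠ 0) (hq1 : ‖q‖ < 1) (P R : ℕ) (s k : ℤ) :
    qInt (conj q * q) (P + R + 1) • (star (gA q) * coeffElem q P R s k) =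
      (q ^ s * conj q ^ P * qInt (conj q * q) (P + R - s + 1)) •
          coeffElem q P (R + 1) s (k + 1) +
        qInt (conj q * q) P • coeffElem q (P - 1) R (s - 1) k := by
  have hp : conj q ≠ 0 := (map_ne_zero _).2 hq
  have hrec := congrArg (fun y => toC q (g q .Ds * y * dPow q k))
    ((isQuantumMatrix hq).d_mul_columnCoeff hp hq (conj_mul_self_ne_one hq1) P R (s - 1))
  simp only [mul_add, add_mul, mul_smul_comm, smul_mul_assoc, ← mul_assoc, g_Ds_D, one_mul,
    ← g_as_eq, map_add, map_smul, toC_mul_mul_dPow, toC_mul_dPow, toC_g, toCLetter,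
    sub_add_cancel] at hrec
  rw [hrec, star_gD_mul_coeffElem hq, smul_smul, Nat.cast_succ, ← one_mul (qInt _ (P : ℤ)),
    mul_qInt_smul_coeffElem_pred_left]
  congr 2
  rw [show (P : ℤ) + R - (s - 1) = P + R - s + 1 by ring]
  simp only [zpow_sub₀ (div_ne_zero hq hp), div_zpow, div_pow, zpow_natCast]
  field_simp

theorem star_gB_mul_coeffElem (hq : q ≠ 0) (hq1 : ‖q‖ < 1) (P R : ℕ) (s k : ℤ) :
    qInt (conj q * q) (P + R + 1) • (star (gB q) * coeffElem q P R s k) =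
      (-(conj q ^ P * q ^ (s - P - 1) * qInt (conj q * q) (P + R - s + 1))) •
          coeffElem q (P + 1) R s (k + 1) +
        (conj q ^ P * qInt (conj q * q) R) • coeffElem q P (R - 1) (s - 1) k := by
  have hp : conj q ≠ 0 := (map_ne_zero _).2 hq
  have hrec := congrArg (fun y => (-(conj q)⁻¹) • toC q (g q .Ds * y * dPow q k))
    ((isQuantumMatrix hq).c_mul_columnCoeff hp hq (conj_mul_self_ne_one hq1) P R (s - 1))
  simp only [mul_sub, sub_mul, mul_smul_comm, smul_mul_assoc, ← mul_assoc, g_Ds_D, one_mul,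
    map_sub, map_smul, toC_mul_mul_dPow, toC_mul_dPow, toC_g, toCLetter,
    sub_add_cancel] at hrec
  have hstar : star (gB q) = (-(conj q)⁻¹) • toC q (g q .Ds * polyC q) := by
    rw [← map_smul, ← g_bs_eq hq, toC_g]; rfl
  rw [hstar, smul_mul_assoc, smul_comm, hrec, star_gD_mul_coeffElem hq,
    mul_qInt_smul_coeffElem_pred_right, smul_sub, smul_smul, smul_smul, smul_smul, sub_eq_add_neg,
    ← neg_smul, Nat.cast_succ]
  congr 2
  · rw [show (P : ℤ) + R - (s - 1) = P + R - s + 1 by ring]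
    simp only [zpow_sub₀ (div_ne_zero hq hp), zpow_add_one₀ hp, zpow_add_one₀ hq, zpow_sub_one₀ hq,
      zpow_sub₀ hq, div_zpow, zpow_natCast]
    field_simp
  · rw [pow_succ']
    field_simp

end coeffElemAction

section eElem

variable {q : ℂ}

theorem isIndex_iff {P R s M : ℤ} (h : P + R = s + M) :
    IsIndex (P + R) (M - s) (R - P) ↔ 0 ≤ P ∧ 0 ≤ R ∧ 0 ≤ s ∧ 0 ≤ M := by
  simp only [IsIndex, abs_le, Int.even_iff]
  omega

theorem IsIndex.exists_eq {L I J : ℤ} (h : IsIndex L I J) : ∃ P R s M : ℕ,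
    P + R = s + M ∧ L = P + R ∧ I = M - s ∧ J = R - P := by
  obtain ⟨hI, hJ, ⟨s, hs⟩, ⟨P, hP⟩⟩ := h
  rw [abs_le] at hI hJ
  exact ⟨P.toNat, (L - P).toNat, s.toNat, (L - s).toNat, by omega, by omega, by omega, by omega⟩

theorem matCoeff_eq (hq : q ≠ 0) (hq1 : ‖q‖ < 1) {P R s M : ℕ} (hN : P + R = s + M) :
    matCoeff q (P + R) (M - s) (R - P) =
      ((√(qBinomial (‖q‖ ^ 2) (P + R) R) / √(qBinomial (‖q‖ ^ 2) (P + R) M) : ℝ) : ℂ) •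
        toC q (polyCoeff q P R s) := by
  have hx0 : 0 < ‖q‖ ^ 2 := pow_pos (norm_pos_iff.2 hq) 2
  rw [matCoeff, show (((P : ℤ) + R - (R - P)) / 2).toNat = P by omega,
    show (((P : ℤ) + R + (R - P)) / 2).toNat = R by omega,
    show (((P : ℤ) + R - (M - s)) / 2).toNat = s by omega,
    show (((P : ℤ) + R + (M - s)) / 2).toNat = M by omega,
    show ((P : ℤ) + R).toNat = P + R by omega, polyCoeff,
    (isQuantumMatrix hq).columnCoeff_apply hq, map_sum, Finset.smul_sum]
  refine Finset.sum_congr rfl fun ij hij => ?_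
  obtain ⟨hP, hR⟩ := (Finset.mem_filter.1 hij).2
  simp only [map_smul, map_mul, map_pow, toC_g, toCLetter, toC_polyC, toC_polyD, smul_smul,
    gaussBinom_conj_mul_self, gaussBinom_eq_qBinomial hx0 (norm_sq_lt_one hq1), hP, hR]
  congr 1
  push_cast
  ring

theorem qNumber_succ_eq {r : ℝ} (hr : 0 < r) (hr1 : r < 1) (n : ℕ) :
    qNumber r (n + 1) = (r ^ n)⁻¹ * qInt (r ^ 2) (n + 1) := by
  have hsq : 1 - r ^ 2 ≠ 0 := (sub_pos.2 (pow_lt_one₀ hr.le hr1 two_ne_zero)).ne'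
  have hinv : r - r⁻¹ ≠ 0 := (sub_neg.2 (hr1.trans (one_lt_inv₀ hr |>.2 hr1))).ne
  have hpow : (r ^ 2) ^ ((n : ℤ) + 1) = (r ^ (n + 1)) ^ 2 := by
    rw [← Nat.cast_succ, zpow_natCast, pow_right_comm]
  rw [qNumber, qInt, div_eq_iff hinv, hpow, zpow_neg, zpow_add_one₀ hr.ne', zpow_natCast, pow_succ]
  field_simp
  ring

theorem eElem_scalar_eq (hq : q ≠ 0) (hq1 : ‖q‖ < 1) {P R s M : ℕ} (hN : P + R = s + M) :
    ‖q‖ ^ (-(((M : ℤ) - s : ℤ) : ℝ) / 2) * √(qNumber ‖q‖ ((P : ℤ) + R + 1)) *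
      (√(qBinomial (‖q‖ ^ 2) (P + R) R) / √(qBinomial (‖q‖ ^ 2) (P + R) M)) =
    ‖q‖ ^ (-(M : ℤ)) * normConst (‖q‖ ^ 2) P R s M := by
  have hr : 0 < ‖q‖ := norm_pos_iff.2 hq
  have hF (n : ℕ) : 0 < qFactorial (‖q‖ ^ 2) n :=
    qFactorial_pos (sq_nonneg ‖q‖) (norm_sq_lt_one hq1) n
  have hK : qNumber ‖q‖ ((P : ℤ) + R + 1) = (‖q‖ ^ (P + R))⁻¹ * qInt (‖q‖ ^ 2) (P + R + 1) :=
    mod_cast qNumber_succ_eq hr hq1 (P + R)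
  have hpow : ‖q‖ ^ (-(((M : ℤ) - s : ℤ) : ℝ) / 2) = √(‖q‖ ^ ((s : ℤ) - M)) := by
    rw [Real.sqrt_eq_rpow, ← Real.rpow_intCast, ← Real.rpow_mul hr.le]
    congr 1
    push_cast
    ring
  have hsqrt : ‖q‖ ^ (-(M : ℤ)) = √((‖q‖ ^ (-(M : ℤ))) ^ 2) :=
    (Real.sqrt_sq (zpow_pos hr _).le).symm
  have hB (k : ℕ) : 0 ≤ qBinomial (‖q‖ ^ 2) (P + R) k :=
    (div_pos (hF _) (mul_pos (hF _) (hF _))).le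
  rw [hpow, hsqrt, normConst, ← Real.sqrt_div (hB _), ← Real.sqrt_mul (zpow_pos hr _).le,
    ← Real.sqrt_mul' _ (div_nonneg (hB _) (hB _)), ← Real.sqrt_mul (sq_nonneg _), hK, qBinomial,
    qBinomial, Nat.add_sub_cancel, show P + R - M = s by omega, zpow_sub₀ hr.ne', zpow_neg,
    zpow_natCast, zpow_natCast, hN, pow_add]
  have hP := (hF P).ne'
  have hR := (hF R).ne'
  have hs := (hF s).ne'
  have hM := (hF M).ne'
  have hsM := (hF (s + M)).ne'
  congr 1
  field_simp

theorem eElem_eq (hq : q ≠ 0) (hq1 : ‖q‖ < 1) {L I J P R s M : ℤ} (hcol : L = P + R)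
    (hrow : L = s + M) (hI : I = M - s) (hJ : J = R - P) (k : ℤ) :
    eElem q L I J k =
      ((‖q‖ ^ (-M) * normConst (‖q‖ ^ 2) P.toNat R.toNat s.toNat M.toNat : ℝ) : ℂ) •
        coeffElem q P R s k := by
  subst hcol hI hJ
  rw [eElem]
  split_ifs with hind
  · obtain ⟨hP, hR, hs, hM⟩ := (isIndex_iff hrow).1 hind
    lift P to ℕ using hP
    lift R to ℕ using hR
    lift s to ℕ using hs
    lift M to ℕ using hM
    simp only [Int.toNat_natCast]
    rw [matCoeff_eq hq hq1 (mod_cast hrow), ← eElem_scalar_eq hq hq1 (mod_cast hrow),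
      coeffElem_natCast, map_mul, toC_dPow, smul_mul_assoc, smul_smul, ← Complex.ofReal_mul]
  · rw [isIndex_iff hrow] at hind
    rw [coeffElem_eq_zero (by omega), smul_zero]

theorem root_eq_ladderRoot (hq1 : ‖q‖ < 1) {u v w U V n : ℤ} (hu : u = 2 * U) (hv : v = 2 * V)
    (hw : w = 2 * n) : root q u v w = (ladderRoot (‖q‖ ^ 2) U V n : ℂ) := by
  have hne : 1 - ‖q‖ ^ 2 ≠ 0 := (sub_pos.2 (norm_sq_lt_one hq1)).ne'
  have hpow (m : ℤ) : ‖q‖ ^ (2 * m) = (‖q‖ ^ 2) ^ m := by rw [zpow_mul]; rfl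
  rw [root, ladderRoot, hu, hv, hw, show 2 * n + 2 = 2 * (n + 1) by ring]
  simp only [hpow, qInt]
  congr 2
  field_simp

end eElem

section eElemAction

variable {q : ℂ}

theorem toC_dPow_mul_eElem (hq : q ≠ 0) (hq1 : ‖q‖ < 1) {L I J : ℤ} (h : IsIndex L I J)
    (j k : ℤ) : toC q (dPow q j) * eElem q L I J k =
      (q / conj q) ^ ((J - I) / 2 * j) • eElem q L I J (k + j) := by
  obtain ⟨P, R, s, M, hN, rfl, hI, hJ⟩ := h.exists_eq
  have he := eElem_eq hq hq1 rfl (mod_cast hN) hI hJ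
  rw [he, he, mul_smul_comm, toC_dPow_mul_coeffElem hq, smul_comm,
    show (J - I) / 2 = s - P by omega]

theorem gD_mul_eElem (hq : q ≠ 0) (hq1 : ‖q‖ < 1) {L I J : ℤ} (h : IsIndex L I J) (k : ℤ) :
    gD q * eElem q L I J k = (q / conj q) ^ ((I - J) / 2) • eElem q L I J (k - 1) := by
  have hIJ : (J - I) / 2 * -1 = (I - J) / 2 := by
    obtain ⟨-, -, ⟨s, hs⟩, ⟨P, hP⟩⟩ := h
    omega
  have hact := toC_dPow_mul_eElem hq hq1 h (-1) k
  rwa [dPow_neg_one, toC_g, hIJ] at hact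

theorem star_gD_mul_eElem (hq : q ≠ 0) (hq1 : ‖q‖ < 1) {L I J : ℤ} (h : IsIndex L I J) (k : ℤ) :
    star (gD q) * eElem q L I J k = (conj q / q) ^ ((I - J) / 2) • eElem q L I J (k + 1) := by
  have hIJ : (J - I) / 2 * 1 = -((I - J) / 2) := by
    obtain ⟨-, -, ⟨s, hs⟩, ⟨P, hP⟩⟩ := h
    omega
  have hact := toC_dPow_mul_eElem hq hq1 h 1 k
  rwa [dPow_one, toC_g, hIJ, zpow_neg, ← inv_zpow, inv_div] at hact

theorem smul_eq_add_of_smul_eq_add {K V : Type*} [Field K] [AddCommGroup V] [Module K V]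
    {n ν u i μ v j κ : K} {y up down : V} (hn : n ≠ 0)
    (hy : n • y = (u * i) • up + (v * j) • down) (hup : i * ν = n * μ)
    (hdown : (j * ν) • down = (n * κ) • down) :
    ν • y = (u * μ) • up + (v * κ) • down := by
  refine smul_right_injective V hn ?_
  calc n • ν • y = (u * (i * ν)) • up + v • (j * ν) • down := by
        rw [smul_comm, hy]; module
    _ = n • ((u * μ) • up + (v * κ) • down) := by rw [hup, hdown]; module

theorem qInt_mul_normConst_pred_smul (hq1 : ‖q‖ < 1) {P R s M : ℕ} {y : CUq2 q}
    (hy : M = 0 → R ≠ 0 → y = 0) :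
    (qInt (conj q * q) R * normConst (‖q‖ ^ 2) P R s M) • y =
      (qInt (conj q * q) (P + R + 1) *
        (ladderRoot (‖q‖ ^ 2) R M (P + R) * normConst (‖q‖ ^ 2) P (R - 1) s (M - 1) : ℝ)) • y := by
  rcases R with _ | R
  · simp [ladderRoot, qInt_zero]
  rcases M with _ | M
  · rw [hy rfl R.succ_ne_zero, smul_zero, smul_zero]
  congr 1
  simp only [qInt_conj_mul_self, ← Complex.ofReal_mul, Nat.add_sub_cancel]
  rw [Nat.cast_succ, Nat.cast_succ, ← add_assoc]
  exact congrArg _ (qInt_mul_normConst_lower (sq_nonneg ‖q‖) (norm_sq_lt_one hq1) P R s M)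

theorem qInt_mul_normConst_succ (hq1 : ‖q‖ < 1) (P R s M : ℕ) :
    qInt (conj q * q) (s + 1) * normConst (‖q‖ ^ 2) P R s M = qInt (conj q * q) (P + R + 1) *
      (ladderRoot (‖q‖ ^ 2) (P + 1) (s + 1) (P + R + 1) *
        normConst (‖q‖ ^ 2) (P + 1) R (s + 1) M : ℝ) := by
  simp only [qInt_conj_mul_self, ← Complex.ofReal_mul]
  exact congrArg _ (qInt_mul_normConst_raise (sq_nonneg ‖q‖) (norm_sq_lt_one hq1) P R s M)

theorem gA_mul_eElem (hq : q ≠ 0) (hq1 : ‖q‖ < 1) {L I J : ℤ} (h : IsIndex L I J) (k : ℤ) :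
    gA q * eElem q L I J k = alphaPlus q L I J • eElem q (L + 1) (I - 1) (J - 1) k +
      alphaMinus q L I J • eElem q (L - 1) (I - 1) (J - 1) (k - 1) := by
  have hp : conj q ≠ 0 := (map_ne_zero _).2 hq
  have hr : (‖q‖ : ℂ) ≠ 0 := mod_cast norm_ne_zero_iff.2 hq
  obtain ⟨P, R, s, M, hN, rfl, rfl, rfl⟩ := h.exists_eq
  have hact := smul_eq_add_of_smul_eq_add (u := 1) (mod_cast qInt_conj_mul_self_ne_zero hq1 (P + R))
    ((gA_mul_coeffElem hq hq1 P R s k).trans (by rw [one_mul]))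
    (qInt_mul_normConst_succ hq1 P R s M)
    (qInt_mul_normConst_pred_smul hq1 (s := s) (M := M) fun _ _ => coeffElem_eq_zero (by omega))
  rw [eElem_eq hq hq1 rfl (mod_cast hN) rfl rfl,
    eElem_eq (P := P + 1) (R := R) (s := s + 1) (M := M) hq hq1 (by omega)
      (by omega) (by omega) (by omega),
    eElem_eq (P := P) (R := R - 1) (s := s) (M := M - 1) hq hq1 (by omega)
      (by omega) (by omega) (by omega),
    alphaPlus, alphaMinus,
    root_eq_ladderRoot hq1 (U := P + 1) (V := s + 1) (n := P + R + 1) (by omega) (by omega)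
      (by omega),
    root_eq_ladderRoot hq1 (U := R) (V := M) (n := P + R) (by omega) (by omega) (by omega),
    mul_smul_comm, Complex.ofReal_mul, mul_smul]
  simp only [Int.toNat_natCast, Int.toNat_natCast_add_one, Int.pred_toNat]
  rw [hact, show ((P : ℤ) + R - (R - P)) / 2 = P by omega,
    show ((P : ℤ) + R - (M - s)) / 2 + 1 = s + 1 by omega, phase]
  match_scalars
  · ring
  · rw [neg_sub, sub_eq_add_neg 1]
    simp only [zpow_add₀ hr, zpow_one, zpow_natCast, pow_succ]
    field_simp

theorem gB_mul_eElem (hq : q ≠ 0) (hq1 : ‖q‖ < 1) {L I J : ℤ} (h : IsIndex L I J) (k : ℤ) :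
    gB q * eElem q L I J k = betaPlus q L I J • eElem q (L + 1) (I - 1) (J + 1) k +
      betaMinus q L I J • eElem q (L - 1) (I - 1) (J + 1) (k - 1) := by
  have hp : conj q ≠ 0 := (map_ne_zero _).2 hq
  have hr : (‖q‖ : ℂ) ≠ 0 := mod_cast norm_ne_zero_iff.2 hq
  obtain ⟨P, R, s, M, hN, rfl, rfl, rfl⟩ := h.exists_eq
  have hup := qInt_mul_normConst_succ hq1 R P s M
  have hdown := qInt_mul_normConst_pred_smul hq1 (P := R) (R := P) (s := s) (M := M)
    (y := coeffElem q (P - 1) R s (k - 1)) fun _ _ => coeffElem_eq_zero (by omega)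
  rw [add_comm (R : ℤ), normConst_comm_left _ R, normConst_comm_left _ (R + 1)] at hup
  rw [add_comm (R : ℤ), normConst_comm_left _ R, normConst_comm_left _ R] at hdown
  have hact := smul_eq_add_of_smul_eq_add (mod_cast qInt_conj_mul_self_ne_zero hq1 (P + R))
    ((gB_mul_coeffElem hq hq1 P R s k).trans (by rw [sub_eq_add_neg, ← neg_smul, ← neg_mul]))
    hup hdown
  rw [eElem_eq hq hq1 rfl (mod_cast hN) rfl rfl,
    eElem_eq (P := P) (R := R + 1) (s := s + 1) (M := M) hq hq1 (by omega)
      (by omega) (by omega) (by omega),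
    eElem_eq (P := P - 1) (R := R) (s := s) (M := M - 1) hq hq1 (by omega)
      (by omega) (by omega) (by omega),
    betaPlus, betaMinus,
    root_eq_ladderRoot hq1 (U := R + 1) (V := s + 1) (n := P + R + 1) (by omega) (by omega)
      (by omega),
    root_eq_ladderRoot hq1 (U := P) (V := M) (n := P + R) (by omega) (by omega) (by omega),
    mul_smul_comm, Complex.ofReal_mul, mul_smul]
  simp only [Int.toNat_natCast, Int.toNat_natCast_add_one, Int.pred_toNat]
  rw [hact, show ((P : ℤ) + R - (R - P)) / 2 = P by omega,
    show ((R : ℤ) - P - (M - s)) / 2 + 1 = s - P + 1 by omega, phase]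
  match_scalars
  · rw [zpow_natCast]
    ring
  · rw [neg_sub, sub_eq_add_neg 1]
    simp only [zpow_add₀ hr, zpow_one, zpow_sub_one₀ hq, zpow_natCast]
    field_simp

theorem star_gA_mul_eElem (hq : q ≠ 0) (hq1 : ‖q‖ < 1) {L I J : ℤ} (h : IsIndex L I J) (k : ℤ) :
    star (gA q) * eElem q L I J k =
      alphaPlusStar q L I J • eElem q (L + 1) (I + 1) (J + 1) (k + 1) +
      alphaMinusStar q L I J • eElem q (L - 1) (I + 1) (J + 1) k := by
  have hp : conj q ≠ 0 := (map_ne_zero _).2 hq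
  have hr : (‖q‖ : ℂ) ≠ 0 := mod_cast norm_ne_zero_iff.2 hq
  obtain ⟨P, R, s, M, hN, rfl, rfl, rfl⟩ := h.exists_eq
  have hup := qInt_mul_normConst_succ hq1 R P M s
  have hdown := qInt_mul_normConst_pred_smul hq1 (P := R) (R := P) (s := M) (M := s)
    (y := coeffElem q (P - 1) R (s - 1) k) fun _ _ => coeffElem_eq_zero (by omega)
  rw [add_comm (R : ℤ), normConst_comm_left _ R, normConst_comm_left _ (R + 1),
    normConst_comm_right _ _ _ M, normConst_comm_right _ _ _ (M + 1)] at hup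
  rw [add_comm (R : ℤ), normConst_comm_left _ R, normConst_comm_left _ R,
    normConst_comm_right _ _ _ M, normConst_comm_right _ _ _ M] at hdown
  have hact := smul_eq_add_of_smul_eq_add (u := q ^ (s : ℤ) * conj q ^ P) (v := 1)
    (mod_cast qInt_conj_mul_self_ne_zero hq1 (P + R))
    ((star_gA_mul_coeffElem hq hq1 P R s k).trans
      (by rw [show (P : ℤ) + R - s + 1 = M + 1 by omega, one_mul])) hup hdown
  rw [eElem_eq hq hq1 rfl (mod_cast hN) rfl rfl,
    eElem_eq (P := P) (R := R + 1) (s := s) (M := M + 1) hq hq1 (by omega)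
      (by omega) (by omega) (by omega),
    eElem_eq (P := P - 1) (R := R) (s := s - 1) (M := M) hq hq1 (by omega)
      (by omega) (by omega) (by omega),
    alphaPlusStar, alphaMinusStar,
    root_eq_ladderRoot hq1 (U := R + 1) (V := M + 1) (n := P + R + 1) (by omega) (by omega)
      (by omega),
    root_eq_ladderRoot hq1 (U := P) (V := s) (n := P + R) (by omega) (by omega) (by omega),
    mul_smul_comm, Complex.ofReal_mul, mul_smul]
  simp only [Int.toNat_natCast, Int.toNat_natCast_add_one, Int.pred_toNat]
  rw [hact, show ((P : ℤ) + R - (M - s)) / 2 = s by omega,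
    show ((P : ℤ) + R - (R - P)) / 2 + 1 = P + 1 by omega, phase]
  match_scalars
  · rw [neg_add, zpow_add₀ hr, zpow_neg_one]
    simp only [zpow_add_one₀ hp, zpow_natCast]
    field_simp
    rw [norm_sq_eq]
    ring
  · ring

theorem star_gB_mul_eElem (hq : q ≠ 0) (hq1 : ‖q‖ < 1) {L I J : ℤ} (h : IsIndex L I J) (k : ℤ) :
    star (gB q) * eElem q L I J k =
      betaPlusStar q L I J • eElem q (L + 1) (I + 1) (J - 1) (k + 1) +
      betaMinusStar q L I J • eElem q (L - 1) (I + 1) (J - 1) k := by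
  have hp : conj q ≠ 0 := (map_ne_zero _).2 hq
  have hr : (‖q‖ : ℂ) ≠ 0 := mod_cast norm_ne_zero_iff.2 hq
  obtain ⟨P, R, s, M, hN, rfl, rfl, rfl⟩ := h.exists_eq
  have hup := qInt_mul_normConst_succ hq1 P R M s
  have hdown := qInt_mul_normConst_pred_smul hq1 (P := P) (R := R) (s := M) (M := s)
    (y := coeffElem q P (R - 1) (s - 1) k) fun _ _ => coeffElem_eq_zero (by omega)
  rw [normConst_comm_right _ _ _ M, normConst_comm_right _ _ _ (M + 1)] at hup
  rw [normConst_comm_right _ _ _ M, normConst_comm_right _ _ _ M] at hdown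
  have hact := smul_eq_add_of_smul_eq_add (mod_cast qInt_conj_mul_self_ne_zero hq1 (P + R))
    ((star_gB_mul_coeffElem hq hq1 P R s k).trans
      (by rw [show (P : ℤ) + R - s + 1 = M + 1 by omega, ← neg_mul])) hup hdown
  rw [eElem_eq hq hq1 rfl (mod_cast hN) rfl rfl,
    eElem_eq (P := P + 1) (R := R) (s := s) (M := M + 1) hq hq1 (by omega)
      (by omega) (by omega) (by omega),
    eElem_eq (P := P) (R := R - 1) (s := s - 1) (M := M) hq hq1 (by omega)
      (by omega) (by omega) (by omega),
    betaPlusStar, betaMinusStar,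
    root_eq_ladderRoot hq1 (U := P + 1) (V := M + 1) (n := P + R + 1) (by omega) (by omega)
      (by omega),
    root_eq_ladderRoot hq1 (U := R) (V := s) (n := P + R) (by omega) (by omega) (by omega),
    mul_smul_comm, Complex.ofReal_mul, mul_smul]
  simp only [Int.toNat_natCast, Int.toNat_natCast_add_one, Int.pred_toNat]
  rw [hact, show ((R : ℤ) - P - (M - s)) / 2 - 1 = s - P - 1 by omega,
    show ((P : ℤ) + R - (R - P)) / 2 = P by omega, phase]
  match_scalars
  · rw [neg_add, zpow_add₀ hr, zpow_neg_one]
    simp only [zpow_add_one₀ hp, zpow_sub_one₀ hq, zpow_natCast]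
    field_simp
    rw [norm_sq_eq]
    ring
  · rw [zpow_natCast]
    ring

end eElemAction

/-! ## The Haar state -/

section triShift

/-- The values on the letters of the upper triangular representation `triRep`. -/
def triLetter (q z w : ℂ) : Letter → Matrix (Fin 2) (Fin 2) ℂ
  | .a => !![z, 0; 0, q * z]
  | .as => !![z⁻¹, 0; 0, (q * z)⁻¹]
  | .b => !![0, 1; 0, 0]
  | .bs => 0
  | .D => !![w, 0; 0, q / conj q * w]
  | .Ds => !![w⁻¹, 0; 0, (q / conj q * w)⁻¹]

variable {q z w : ℂ}

/-- A family of two-dimensional, not `*`-preserving, representations of `O(U_q(2))`. The diagonal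
entries are the characters given by the diagonal torus; the off-diagonal entry is a raising operator
of the dual quantum enveloping algebra. -/
def triRep (hq : q ≠ 0) (hz : z ≠ 0) (hw : w ≠ 0) : Poly q →ₐ[ℂ] Matrix (Fin 2) (Fin 2) ℂ :=
  RingQuot.liftAlgHom ℂ ⟨FreeAlgebra.lift ℂ (triLetter q z w), by
    have hp : conj q ≠ 0 := (map_ne_zero _).2 hq
    intro x y hxy
    cases hxy <;>
      simp only [map_mul, map_add, map_smul, map_one, FreeAlgebra.lift_ι_apply, triLetter,
        norm_sq_eq] <;>
      ext i j <;> fin_cases i <;> fin_cases j <;>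
      simp [Matrix.mul_apply, Fin.sum_univ_two, hz, hw] <;> field_simp⟩

/-- The algebra homomorphism `(id ⊗ ρ)Δ` for the triangular representation `ρ = triRep`. -/
def triShift (hq : q ≠ 0) (hz : z ≠ 0) (hw : w ≠ 0) :
    Poly q →ₐ[ℂ] Matrix (Fin 2) (Fin 2) (Poly q) :=
  ((matrixEquivTensor (Fin 2) ℂ (Poly q)).symm : _ →ₐ[ℂ] _).comp
    ((Algebra.TensorProduct.map (AlgHom.id ℂ (Poly q)) (triRep hq hz hw)).comp (comul q))

variable (hq : q ≠ 0) (hz : z ≠ 0) (hw : w ≠ 0)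

theorem restr_triShift {h : CUq2 q →ₚ[ℂ] ℂ} (hh : IsHaarState q h) (x : Poly q) (i j : Fin 2) :
    restr q h (triShift hq hz hw x i j) = restr q h x * (1 : Matrix (Fin 2) (Fin 2) ℂ) i j := by
  have hslice (t : Poly q ⊗[ℂ] Poly q) :
      restr q h ((matrixEquivTensor (Fin 2) ℂ (Poly q)).symm
        (Algebra.TensorProduct.map (AlgHom.id ℂ (Poly q)) (triRep hq hz hw) t) i j) =
      triRep hq hz hw (TensorProduct.lid ℂ (Poly q) ((restr q h).rTensor (Poly q) t)) i j := by
    induction t using TensorProduct.induction_on with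
    | zero => simp
    | add t u ht hu => simp [ht, hu]
    | tmul x y =>
      simp only [Algebra.TensorProduct.map_tmul, AlgHom.id_apply, matrixEquivTensor_apply_symm,
        LinearMap.rTensor_tmul, TensorProduct.lid_tmul, map_smul, Matrix.smul_apply,
        Matrix.map_apply, smul_eq_mul, Algebra.algebraMap_eq_smul_one, mul_smul_comm, mul_one]
      ring
  refine (hslice (comul q x)).trans ?_
  rw [hh.left_invariant x, map_smul, map_one]
  rfl

theorem triRep_g (x : Letter) : triRep hq hz hw (g q x) = triLetter q z w x := by
  simp [triRep, g]

theorem comul_g (x : Letter) : comul q (g q x) = comulLetter q x := by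
  simp [comul, g]

theorem matrixEquivTensor_symm_map_triRep_tmul (x y : Poly q) :
    (matrixEquivTensor (Fin 2) ℂ (Poly q)).symm
      (Algebra.TensorProduct.map (AlgHom.id ℂ (Poly q)) (triRep hq hz hw) (x ⊗ₜ y)) =
      (triRep hq hz hw y).map (· • x) := by
  ext i j
  simp [matrixEquivTensor_apply_symm, Algebra.algebraMap_eq_smul_one]

theorem triShift_g (x : Letter) : triShift hq hz hw (g q x) =
    (matrixEquivTensor (Fin 2) ℂ (Poly q)).symm
      (Algebra.TensorProduct.map (AlgHom.id ℂ (Poly q)) (triRep hq hz hw) (comulLetter q x)) :=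
  congrArg (fun t => (matrixEquivTensor (Fin 2) ℂ (Poly q)).symm
    (Algebra.TensorProduct.map (AlgHom.id ℂ (Poly q)) (triRep hq hz hw) t)) (comul_g x)

theorem triShift_a :
    triShift hq hz hw (g q .a) = !![z • g q .a, 0; 0, (q * z) • g q .a] := by
  simp only [triShift_g, comulLetter, map_add, map_smul, matrixEquivTensor_symm_map_triRep_tmul,
    map_mul, triRep_g, triLetter, mul_zero]
  ext i j
  fin_cases i <;> fin_cases j <;> simp

theorem triShift_b : triShift hq hz hw (g q .b) =
    !![(w / z) • g q .b, g q .a; 0, (w / (conj q * z)) • g q .b] := by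
  have hratio : q / conj q * w * (q * z)⁻¹ = w / (conj q * z) := by field_simp
  simp only [triShift_g, comulLetter, map_add, matrixEquivTensor_symm_map_triRep_tmul, map_mul,
    triRep_g, triLetter, Matrix.mul_fin_two, mul_zero, zero_mul, add_zero, zero_add, hratio]
  ext i j
  fin_cases i <;> fin_cases j <;> simp [div_eq_mul_inv]

theorem triShift_as : triShift hq hz hw (g q .as) =
    !![z⁻¹ • g q .as, (-(conj q / w)) • g q .bs; 0, (q * z)⁻¹ • g q .as] := by
  have hratio : -q * (q / conj q * w)⁻¹ = -(conj q / w) := by field_simp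
  simp only [triShift_g, comulLetter, map_add, map_smul, matrixEquivTensor_symm_map_triRep_tmul,
    map_mul, triRep_g, triLetter, Matrix.mul_fin_two, mul_zero, zero_mul, add_zero, zero_add,
    one_mul]
  rw [← hratio, mul_smul]
  -- keeps `simp` from moving the sign on one side only
  generalize -q = u
  ext i j
  fin_cases i <;> fin_cases j <;> simp

theorem triShift_bs : triShift hq hz hw (g q .bs) =
    !![(z / w) • g q .bs, 0; 0, (conj q * z / w) • g q .bs] := by
  have hratio : q * z * (q / conj q * w)⁻¹ = conj q * z / w := by field_simp
  simp only [triShift_g, comulLetter, map_add, matrixEquivTensor_symm_map_triRep_tmul, map_mul,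
    triRep_g, triLetter, Matrix.mul_fin_two, mul_zero, zero_mul, add_zero, zero_add, hratio]
  ext i j
  fin_cases i <;> fin_cases j <;> simp [div_eq_mul_inv]

theorem triShift_D : triShift hq hz hw (g q .D) =
    !![w • g q .D, 0; 0, (q / conj q * w) • g q .D] := by
  rw [triShift_g, comulLetter, matrixEquivTensor_symm_map_triRep_tmul, triRep_g, triLetter]
  ext i j
  fin_cases i <;> fin_cases j <;> simp

theorem triShift_Ds : triShift hq hz hw (g q .Ds) =
    !![w⁻¹ • g q .Ds, 0; 0, (q / conj q * w)⁻¹ • g q .Ds] := by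
  rw [triShift_g, comulLetter, matrixEquivTensor_symm_map_triRep_tmul, triRep_g, triLetter]
  ext i j
  fin_cases i <;> fin_cases j <;> simp

theorem triShift_polyC : triShift hq hz hw (polyC q) =
    !![z • polyC q, 0; 0, (q * z) • polyC q] := by
  have hp : conj q ≠ 0 := (map_ne_zero _).2 hq
  have htop : w * (z / w) = z := by field_simp
  have hbot : q / conj q * w * (conj q * z / w) = q * z := by field_simp
  rw [polyC, map_smul, map_mul, triShift_D, triShift_bs, Matrix.mul_fin_two]
  simp only [smul_mul_smul_comm, htop, hbot, mul_zero, zero_mul, add_zero, zero_add]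
  ext i j
  fin_cases i <;> fin_cases j <;> simp [smul_comm z, smul_comm (q * z)]

theorem triShift_polyD : triShift hq hz hw (polyD q) =
    !![(w / z) • polyD q, polyC q; 0, (w / (conj q * z)) • polyD q] := by
  have hoff : w * -(conj q / w) = -conj q := by field_simp
  have hbot : q / conj q * w * (q * z)⁻¹ = w / (conj q * z) := by field_simp
  rw [polyD, polyC, map_mul, triShift_D, triShift_as, Matrix.mul_fin_two]
  simp only [smul_mul_smul_comm, hoff, hbot, mul_zero, zero_mul, add_zero, zero_add,
    div_eq_mul_inv w z]

theorem triShift_dPow (k : ℤ) : triShift hq hz hw (dPow q k) =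
    !![w ^ (-k) • dPow q k, 0; 0, (q / conj q * w) ^ (-k) • dPow q k] := by
  have hw' : q / conj q * w ≠ 0 := mul_ne_zero (div_ne_zero hq ((map_ne_zero _).2 hq)) hw
  induction k with
  | zero => simp [dPow_zero, Matrix.one_fin_two]
  | succ k ih =>
    rw [dPow_add, map_mul, ih, dPow_one, triShift_Ds, Matrix.mul_fin_two, neg_add, zpow_add₀ hw,
      zpow_add₀ hw', zpow_neg_one, zpow_neg_one]
    simp [smul_smul, mul_comm]
  | pred k ih =>
    rw [sub_eq_add_neg, dPow_add, map_mul, ih, dPow_neg_one, triShift_D, Matrix.mul_fin_two,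
      neg_add, zpow_add₀ hw, zpow_add₀ hw', neg_neg (1 : ℤ), zpow_one, zpow_one]
    simp [smul_smul, mul_comm]

theorem qInt_smul_columnStep_polyCoeff_one (hq : q ≠ 0) (R : ℕ) (s : ℤ) :
    qInt (conj q * q) R • (g q .b * polyCoeff q 1 (R - 1) (s - 1) +
      q ^ s • (polyD q * polyCoeff q 1 (R - 1) s)) =
        (q * qInt (conj q * q) R) • polyCoeff q 1 R s := by
  rcases R with _ | R
  · simp
  · rw [Nat.add_sub_cancel, ← columnStep_apply,
      (isQuantumMatrix hq).columnCoeff_succ_right hq 1 R, pow_one, Pi.smul_apply, smul_smul,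
      mul_comm]

theorem triShift_polyCoeff_zero (hq1 : ‖q‖ < 1) (R : ℕ) (s : ℤ) :
    triShift hq hz hw (polyCoeff q 0 R s) = (w / z) ^ R •
      !![polyCoeff q 0 R s, (z / w * conj q * (conj q ^ R)⁻¹ * qInt (conj q * q) R) •
          polyCoeff q 1 (R - 1) s; 0, (conj q ^ R)⁻¹ • polyCoeff q 0 R s] := by
  have hp : conj q ≠ 0 := (map_ne_zero _).2 hq
  induction R generalizing s with
  | zero =>
    have hdiag : triShift hq hz hw (polyCoeff q 0 0 s) = Matrix.scalar _ (polyCoeff q 0 0 s) := by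
      rcases eq_or_ne s 0 with rfl | hs
      · simp [columnCoeff_zero_zero]
      · simp [columnCoeff_zero_zero, hs]
    rw [hdiag]
    ext i j
    fin_cases i <;> fin_cases j <;> simp
  | succ R ih =>
    have hleft : polyCoeff q 1 R s =
        g q .a * polyCoeff q 0 R (s - 1) + q ^ s • (polyC q * polyCoeff q 0 R s) :=
      congrFun (columnCoeff_succ_left 0 R) s
    have hnum : qInt (conj q * q) (R + 1) = 1 + conj q * q * qInt (conj q * q) R := by
      rw [add_comm (R : ℤ), qInt_add (mul_ne_zero hp hq), qInt_one (conj_mul_self_ne_one hq1),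
        zpow_one]
    have hsucc : polyCoeff q 0 (R + 1) s =
        g q .b * polyCoeff q 0 R (s - 1) + q ^ s • (polyD q * polyCoeff q 0 R s) :=
      congrFun (columnCoeff_zero_succ R) s
    rw [Nat.add_sub_cancel, Nat.cast_succ, hnum, hsucc, map_add, map_smul, map_mul, map_mul, ih, ih,
      triShift_b, triShift_polyD, pow_succ (w / z), pow_succ (conj q)]
    simp only [mul_smul_comm, Matrix.mul_fin_two]
    ext i j
    fin_cases i <;> fin_cases j <;>
      simp only [Algebra.smul_mul_assoc, mul_zero, add_zero, zero_mul, smul_zero, zero_add,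
        Matrix.smul_of, Matrix.smul_cons, smul_add, Matrix.smul_empty, Fin.zero_eta, Fin.isValue,
        Fin.mk_one, Matrix.add_apply, Matrix.of_apply, Matrix.cons_val', Matrix.cons_val_one,
        Matrix.cons_val_fin_one, Matrix.cons_val_zero, mul_inv_rev, Matrix.smul_apply]
    · match_scalars <;> field_simp
    · linear_combination (norm := skip)
        ((w / z) ^ R * conj q * (conj q ^ R)⁻¹) • qInt_smul_columnStep_polyCoeff_one hq R s -
          ((w / z) ^ R * (conj q ^ R)⁻¹) • hleft
      match_scalars <;> field_simp <;> ring
    · match_scalars <;> field_simp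

theorem triShift_polyCoeff (hq1 : ‖q‖ < 1) (P R : ℕ) (s : ℤ) :
    triShift hq hz hw (polyCoeff q P R s) = (z ^ P * (w / z) ^ R) •
      !![polyCoeff q P R s, (z / w * conj q * (conj q ^ R)⁻¹ * qInt (conj q * q) R) •
          polyCoeff q (P + 1) (R - 1) s; 0, (q ^ P * (conj q ^ R)⁻¹) • polyCoeff q P R s] := by
  induction P generalizing s with
  | zero => simpa using triShift_polyCoeff_zero hq hz hw hq1 R s
  | succ P ih =>
    have hsucc (P R : ℕ) : polyCoeff q (P + 1) R s =
        g q .a * polyCoeff q P R (s - 1) + q ^ s • (polyC q * polyCoeff q P R s) :=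
      congrFun (columnCoeff_succ_left P R) s
    rw [hsucc P R, hsucc (P + 1) (R - 1), map_add, map_smul, map_mul, map_mul, ih, ih, triShift_a,
      triShift_polyC]
    simp only [mul_smul_comm, Matrix.mul_fin_two]
    ext i j
    fin_cases i <;> fin_cases j <;>
      simp only [Algebra.smul_mul_assoc, mul_zero, add_zero, zero_mul, smul_zero, zero_add,
        Matrix.smul_of, Matrix.smul_cons, smul_add, Matrix.smul_empty, Fin.zero_eta, Fin.isValue,
        Fin.mk_one, Matrix.add_apply, Matrix.of_apply, Matrix.cons_val', Matrix.cons_val_one,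
        Matrix.cons_val_fin_one, Matrix.cons_val_zero, Matrix.smul_apply] <;>
      match_scalars <;> ring

theorem triShift_polyCoeff_mul_dPow_zero_zero (hq1 : ‖q‖ < 1) (P R : ℕ) (s k : ℤ) :
    triShift hq hz hw (polyCoeff q P R s * dPow q k) 0 0 =
      (z ^ P * (w / z) ^ R * w ^ (-k)) • (polyCoeff q P R s * dPow q k) := by
  rw [map_mul, triShift_polyCoeff hq hz hw hq1, triShift_dPow]
  simp [Matrix.mul_apply, smul_smul, mul_comm]

theorem triShift_polyCoeff_mul_dPow_zero_one (hq1 : ‖q‖ < 1) (P R : ℕ) (s k : ℤ) :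
    triShift hq hz hw (polyCoeff q P R s * dPow q k) 0 1 =
      (z ^ P * (w / z) ^ R * (z / w * conj q * (conj q ^ R)⁻¹ * qInt (conj q * q) R) *
        (q / conj q * w) ^ (-k)) • (polyCoeff q (P + 1) (R - 1) s * dPow q k) := by
  rw [map_mul, triShift_polyCoeff hq hz hw hq1, triShift_dPow]
  simp [Matrix.mul_apply, smul_smul, mul_comm]

end triShift

section haar

variable {q : ℂ} {h : CUq2 q →ₚ[ℂ] ℂ}

theorem restr_polyCoeff_succ_mul_dPow (hq : q ≠ 0) (hq1 : ‖q‖ < 1) (hh : IsHaarState q h)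
    (P R : ℕ) (s k : ℤ) : restr q h (polyCoeff q (P + 1) R s * dPow q k) = 0 := by
  have hp : conj q ≠ 0 := (map_ne_zero _).2 hq
  have hR := qInt_conj_mul_self_ne_zero hq1 R
  have hk : (q / conj q) ^ k ≠ 0 := zpow_ne_zero k (div_ne_zero hq hp)
  have hinv := restr_triShift hq one_ne_zero one_ne_zero hh (polyCoeff q P (R + 1) s * dPow q k) 0 1
  rw [triShift_polyCoeff_mul_dPow_zero_one _ _ _ hq1, map_smul, Matrix.one_apply_ne zero_ne_one,
    mul_zero, smul_eq_mul, Nat.add_sub_cancel] at hinv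
  refine (mul_eq_zero.1 hinv).resolve_left ?_
  simp [hp, hR, hk]

theorem restr_polyCoeff_zero_mul_dPow (hq : q ≠ 0) (hq1 : ‖q‖ < 1) (hh : IsHaarState q h)
    {R : ℕ} {k : ℤ} (hRk : R ≠ 0 ∨ k ≠ 0) (s : ℤ) :
    restr q h (polyCoeff q 0 R s * dPow q k) = 0 := by
  have hfixed {z w : ℂ} (hz : z ≠ 0) (hw : w ≠ 0) :
      ((w / z) ^ R * w ^ (-k) - 1) * restr q h (polyCoeff q 0 R s * dPow q k) = 0 := by
    have hinv := restr_triShift hq hz hw hh (polyCoeff q 0 R s * dPow q k) 0 0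
    rw [triShift_polyCoeff_mul_dPow_zero_zero _ _ _ hq1, map_smul, Matrix.one_apply_eq, pow_zero,
      one_mul, smul_eq_mul] at hinv
    linear_combination hinv
  have htwo {n : ℤ} (hn : n ≠ 0) : (2 : ℂ) ^ n - 1 ≠ 0 := by
    rw [sub_ne_zero]
    intro h2
    have hnorm := congrArg norm h2
    rw [norm_zpow, norm_one, Complex.norm_ofNat] at hnorm
    exact hn ((zpow_eq_one_iff_right₀ (by norm_num) (by norm_num)).1 hnorm)
  rcases hRk with hR | hk
  · have hz := hfixed (two_ne_zero (α := ℂ)) one_ne_zero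
    refine (mul_eq_zero.1 hz).resolve_left ?_
    simpa [zpow_neg] using htwo (n := -R) (by simpa using hR)
  · have hz := hfixed (two_ne_zero (α := ℂ)) two_ne_zero
    refine (mul_eq_zero.1 hz).resolve_left ?_
    simpa using htwo (neg_ne_zero.2 hk)

end haar

/-! ## The orthonormal basis -/

section ladder

variable {q : ℂ}

theorem conj_root (u v w : ℤ) : conj (root q u v w) = root q u v w := Complex.conj_ofReal _

theorem conj_phase : conj (phase q) = conj q / ‖q‖ := by
  rw [phase, map_div₀, Complex.conj_ofReal]

theorem phase_ne_zero (hq : q ≠ 0) : phase q ≠ 0 := div_ne_zero hq (mod_cast norm_ne_zero_iff.2 hq)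

theorem root_ne_zero (hq : q ≠ 0) (hq1 : ‖q‖ < 1) {u v w : ℤ} (hu : 0 < u) (hv : 0 < v)
    (hw : 0 < w) : root q u v w ≠ 0 := by
  have hpos {n : ℤ} (hn : 0 < n) : 0 < 1 - ‖q‖ ^ n :=
    sub_pos.2 (zpow_lt_one₀ (norm_pos_iff.2 hq) hq1 hn)
  exact Complex.ofReal_ne_zero.2 (Real.sqrt_pos.2 (div_pos (mul_pos (hpos hu) (hpos hv))
    (mul_pos (hpos hw) (hpos (by omega))))).ne'

theorem conj_alphaPlus (L I J : ℤ) :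
    conj (alphaPlus q L I J) = alphaMinusStar q (L + 1) (I - 1) (J - 1) := by
  rw [alphaMinusStar, alphaPlus, conj_root]
  congr 1 <;> ring

theorem conj_alphaMinus (hq : q ≠ 0) (L I J : ℤ) :
    conj (alphaMinus q L I J) = alphaPlusStar q (L - 1) (I - 1) (J - 1) := by
  have hp : conj q ≠ 0 := (map_ne_zero _).2 hq
  simp only [alphaPlusStar, alphaMinus, map_mul, conj_root, conj_phase, map_zpow₀,
    Complex.conj_conj]
  rw [show L - 1 + (J - 1) + 2 = L + J by ring, show L - 1 + (I - 1) + 2 = L + I by ring,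
    show 2 * (L - 1) + 2 = 2 * L by ring, sub_sub_sub_cancel_right, sub_sub_sub_cancel_right,
    phase, zpow_add_one₀ hq, zpow_add_one₀ hp]
  ring

theorem conj_betaPlus (L I J : ℤ) :
    conj (betaPlus q L I J) = betaMinusStar q (L + 1) (I - 1) (J + 1) := by
  simp only [betaMinusStar, betaPlus, map_mul, conj_root, map_zpow₀]
  rw [add_sub_add_right_eq_sub, show L + 1 + (J + 1) = L + J + 2 by ring,
    show L + 1 - (I - 1) = L - I + 2 by ring, mul_add_one 2 L]

theorem conj_betaMinus (hq : q ≠ 0) (L I J : ℤ) :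
    conj (betaMinus q L I J) = betaPlusStar q (L - 1) (I - 1) (J + 1) := by
  have hp : conj q ≠ 0 := (map_ne_zero _).2 hq
  simp only [betaPlusStar, betaMinus, map_mul, map_neg, conj_root, conj_phase, map_zpow₀,
    Complex.conj_conj]
  rw [show L - 1 - (J + 1) + 2 = L - J by ring, show L - 1 + (I - 1) + 2 = L + I by ring,
    show 2 * (L - 1) + 2 = 2 * L by ring, show (J + 1 - (I - 1)) / 2 - 1 = (J - I) / 2 by omega,
    show (L - 1 - (J + 1)) / 2 + 1 = (L - J) / 2 - 1 + 1 by omega, phase, zpow_add_one₀ hq,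
    zpow_add_one₀ hp]
  ring

/-- Left multiplication by `x` shifts the labels of the `eElem q L I J k` by `(1, ε, δ, κ)` and
`(-1, ε, δ, κ - 1)`, with coefficients `up` and `down`; left multiplication by `star x` is the
formal adjoint, with coefficients `upStar` and `downStar`. -/
structure IsLadder (q : ℂ) (x : CUq2 q) (ε δ κ : ℤ) (up down upStar downStar : ℤ → ℤ → ℤ → ℂ) :
    Prop where
  mul_eElem {L I J : ℤ} (hi : IsIndex L I J) (k : ℤ) :
    x * eElem q L I J k = up L I J • eElem q (L + 1) (I + ε) (J + δ) (k + κ) +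
      down L I J • eElem q (L - 1) (I + ε) (J + δ) (k + κ - 1)
  star_mul_eElem {L I J : ℤ} (hi : IsIndex L I J) (k : ℤ) :
    star x * eElem q L I J k = upStar L I J • eElem q (L + 1) (I - ε) (J - δ) (k - κ + 1) +
      downStar L I J • eElem q (L - 1) (I - ε) (J - δ) (k - κ)
  conj_up (L I J : ℤ) : conj (up L I J) = downStar (L + 1) (I + ε) (J + δ)
  conj_down (L I J : ℤ) : conj (down L I J) = upStar (L - 1) (I + ε) (J + δ)

theorem isLadder_gA (hq : q ≠ 0) (hq1 : ‖q‖ < 1) : IsLadder q (gA q) (-1) (-1) 0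
    (alphaPlus q) (alphaMinus q) (alphaPlusStar q) (alphaMinusStar q) where
  mul_eElem hi k := by
    simpa only [add_zero, ← sub_eq_add_neg] using gA_mul_eElem hq hq1 hi k
  star_mul_eElem hi k := by
    simpa only [sub_zero, sub_neg_eq_add] using star_gA_mul_eElem hq hq1 hi k
  conj_up := conj_alphaPlus
  conj_down := conj_alphaMinus hq

theorem isLadder_gB (hq : q ≠ 0) (hq1 : ‖q‖ < 1) : IsLadder q (gB q) (-1) 1 0
    (betaPlus q) (betaMinus q) (betaPlusStar q) (betaMinusStar q) where
  mul_eElem hi k := by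
    simpa only [add_zero, ← sub_eq_add_neg] using gB_mul_eElem hq hq1 hi k
  star_mul_eElem hi k := by
    simpa only [sub_zero, sub_neg_eq_add] using star_gB_mul_eElem hq hq1 hi k
  conj_up := conj_betaPlus
  conj_down := conj_betaMinus hq

variable {x : CUq2 q} {ε δ κ : ℤ} {up down upStar downStar : ℤ → ℤ → ℤ → ℂ}

theorem IsLadder.symm (hx : IsLadder q x ε δ κ up down upStar downStar) :
    IsLadder q (star x) (-ε) (-δ) (1 - κ) upStar downStar up down where
  mul_eElem hi k := by
    convert hx.star_mul_eElem hi k using 4 <;> ring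
  star_mul_eElem hi k := by
    rw [star_star]
    convert hx.mul_eElem hi k using 4 <;> ring
  conj_up L I J := by
    have h := congrArg conj (hx.conj_down (L + 1) (I - ε) (J - δ))
    rw [Complex.conj_conj, add_sub_cancel_right, sub_add_cancel, sub_add_cancel] at h
    exact h.symm
  conj_down L I J := by
    have h := congrArg conj (hx.conj_up (L - 1) (I - ε) (J - δ))
    rw [Complex.conj_conj, sub_add_cancel, sub_add_cancel, sub_add_cancel] at h
    exact h.symm

theorem IsIndex.exists_isLadder (hq : q ≠ 0) (hq1 : ‖q‖ < 1) {L I J : ℤ} (hL : 0 ≤ L)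
    (hi : IsIndex (L + 1) I J) : ∃ x ε δ κ up down upStar downStar,
      IsLadder q x ε δ κ up down upStar downStar ∧ IsIndex L (I - ε) (J - δ) ∧
        up L (I - ε) (J - δ) ≠ 0 := by
  have hp : conj q ≠ 0 := (map_ne_zero _).2 hq
  have hphase := phase_ne_zero hq
  simp only [IsIndex, abs_le, Int.even_iff] at hi ⊢
  by_cases hI : I = L + 1 <;> by_cases hJ : J = L + 1
  · refine ⟨_, _, _, _, _, _, _, _, (isLadder_gA hq hq1).symm, by omega, ?_⟩
    refine mul_ne_zero ?_ (root_ne_zero hq hq1 (by omega) (by omega) (by omega))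
    simp [hq, hp, hphase, zpow_ne_zero]
  · refine ⟨_, _, _, _, _, _, _, _, (isLadder_gB hq hq1).symm, by omega, ?_⟩
    refine mul_ne_zero ?_ (root_ne_zero hq hq1 (by omega) (by omega) (by omega))
    simp [hq, hp, hphase, zpow_ne_zero]
  · refine ⟨_, _, _, _, _, _, _, _, isLadder_gB hq hq1, by omega, ?_⟩
    exact mul_ne_zero (zpow_ne_zero _ hq) (root_ne_zero hq hq1 (by omega) (by omega) (by omega))
  · refine ⟨_, _, _, _, _, _, _, _, isLadder_gA hq hq1, by omega, ?_⟩
    exact root_ne_zero hq hq1 (by omega) (by omega) (by omega)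

end ladder

section gns

variable {q : ℂ} (h : CUq2 q →ₚ[ℂ] ℂ)

/-- The canonical map `C(U_q(2)) → L²(h)`. -/
def toGNS : CUq2 q →ₗ[ℂ] h.GNS :=
  (UniformSpace.Completion.toComplₗᵢ (𝕜 := ℂ) (E := h.PreGNS)).toLinearMap ∘ₗ
    h.toPreGNS.toLinearMap

theorem eVec_eq (L I J k : ℤ) : eVec q h L I J k = toGNS h (eElem q L I J k) := rfl

theorem gns_toGNS (x y : CUq2 q) : h.gnsStarAlgHom x (toGNS h y) = toGNS h (x * y) :=
  PositiveLinearMap.gnsNonUnitalStarAlgHom_apply_coe h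

theorem inner_toGNS (x y : CUq2 q) : inner ℂ (toGNS h x) (toGNS h y) = h (star x * y) :=
  UniformSpace.Completion.inner_coe _ _

theorem inner_toGNS_mul_left (x y z : CUq2 q) :
    inner ℂ (toGNS h (x * y)) (toGNS h z) = inner ℂ (toGNS h y) (toGNS h (star x * z)) := by
  rw [inner_toGNS, inner_toGNS, star_mul, mul_assoc]

theorem continuous_toGNS : Continuous (toGNS h) := by
  have hc : Continuous h := map_continuous h
  have hnorm (x : CUq2 q) : ‖toGNS h x‖ = √(h (star x * x)).re :=
    (UniformSpace.Completion.norm_coe _).trans (h.preGNS_norm_def _)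
  refine continuous_of_continuousAt_zero (toGNS h) ?_
  rw [ContinuousAt, map_zero, tendsto_zero_iff_norm_tendsto_zero]
  simp only [hnorm]
  have hsqrt : Continuous fun x => √(h (star x * x)).re := by fun_prop
  simpa using hsqrt.tendsto 0

theorem denseRange_toGNS : DenseRange (toGNS h) :=
  UniformSpace.Completion.denseRange_coe.comp h.toPreGNS.surjective.denseRange
    (UniformSpace.Completion.continuous_coe _)

end gns

section orthonormal

variable {q : ℂ} {h : CUq2 q →ₚ[ℂ] ℂ}

theorem eElem_zero (hq : q ≠ 0) (hq1 : ‖q‖ < 1) (k : ℤ) : eElem q 0 0 0 k = toC q (dPow q k) := by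
  have hzero := eElem_eq hq hq1 (q := q) (L := 0) (I := 0) (J := 0) (P := 0) (R := 0) (s := 0)
    (M := 0) rfl rfl rfl rfl k
  have hcoeff : coeffElem q 0 0 0 k = toC q (dPow q k) := by
    simp [coeffElem, columnCoeff_zero_zero]
  rw [hzero, hcoeff]
  simp [normConst, qFactorial_zero, qInt_one (pow_lt_one₀ (norm_nonneg q) hq1 two_ne_zero).ne]

theorem haar_eElem (hq : q ≠ 0) (hq1 : ‖q‖ < 1) (hh : IsHaarState q h) {L I J : ℤ}
    (hi : IsIndex L I J) (k : ℤ) : h (eElem q L I J k) = if L = 0 ∧ k = 0 then 1 else 0 := by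
  split_ifs with hLk
  · obtain ⟨rfl, rfl⟩ := hLk
    obtain rfl : I = 0 := abs_nonpos_iff.1 hi.1
    obtain rfl : J = 0 := abs_nonpos_iff.1 hi.2.1
    rw [eElem_zero hq hq1, dPow_zero, map_one, hh.map_one]
  · obtain ⟨P, R, s, M, hN, rfl, hI, hJ⟩ := hi.exists_eq
    have hcoeff : restr q h (polyCoeff q P R s * dPow q k) = 0 := by
      rcases P with _ | P
      · exact restr_polyCoeff_zero_mul_dPow hq hq1 hh (by omega) s
      · exact restr_polyCoeff_succ_mul_dPow hq hq1 hh P R s k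
    rw [eElem_eq hq hq1 rfl (mod_cast hN) hI hJ, coeffElem_natCast, map_smul]
    exact smul_eq_zero_of_right _ hcoeff

/-- The vectors `e^ℓ_{i,j,k}` with `L = 2ℓ` are unit vectors, orthogonal to each other and to all
the other `e^ℓ'_{i',j',k'}`. -/
def OrthonormalAt (h : CUq2 q →ₚ[ℂ] ℂ) (L : ℤ) : Prop :=
  ∀ ⦃I J : ℤ⦄, IsIndex L I J → ∀ k L' I' J' k' : ℤ,
    inner ℂ (eVec q h L I J k) (eVec q h L' I' J' k') =
      if L = L' ∧ I = I' ∧ J = J' ∧ k = k' then 1 else 0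

theorem eVec_of_not_isIndex {L I J : ℤ} (hi : ¬ IsIndex L I J) (k : ℤ) :
    eVec q h L I J k = 0 := by
  rw [eVec_eq, eElem, if_neg hi, map_zero]

theorem orthonormalAt_of_neg {L : ℤ} (hL : L < 0) : OrthonormalAt h L := fun I _ hi =>
  absurd ((abs_nonneg I).trans hi.1) hL.not_ge

theorem inner_eVec_of_not_isIndex {L I J L' I' J' : ℤ} (hi : IsIndex L I J)
    (hi' : ¬ IsIndex L' I' J') (k k' : ℤ) :
    inner ℂ (eVec q h L I J k) (eVec q h L' I' J' k') =
      if L = L' ∧ I = I' ∧ J = J' ∧ k = k' then 1 else 0 := by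
  rw [eVec_of_not_isIndex hi', inner_zero_right, if_neg]
  rintro ⟨rfl, rfl, rfl, -⟩
  exact hi' hi

theorem OrthonormalAt.inner_eVec {L : ℤ} (hL : OrthonormalAt h L) {L' I' J' : ℤ}
    (hi' : IsIndex L' I' J') (I J k k' : ℤ) :
    inner ℂ (eVec q h L I J k) (eVec q h L' I' J' k') =
      if L = L' ∧ I = I' ∧ J = J' ∧ k = k' then 1 else 0 := by
  by_cases hi : IsIndex L I J
  · exact hL hi k L' I' J' k'
  · rw [eVec_of_not_isIndex hi, inner_zero_left, if_neg]
    rintro ⟨rfl, rfl, rfl, -⟩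
    exact hi hi'

theorem orthonormalAt_zero (hq : q ≠ 0) (hq1 : ‖q‖ < 1) (hh : IsHaarState q h) :
    OrthonormalAt h 0 := by
  intro I J hi k L' I' J' k'
  by_cases hi' : IsIndex L' I' J'
  swap
  · exact inner_eVec_of_not_isIndex hi hi' k k'
  obtain rfl : I = 0 := abs_nonpos_iff.1 hi.1
  obtain rfl : J = 0 := abs_nonpos_iff.1 hi.2.1
  have hinner : inner ℂ (eVec q h 0 0 0 k) (eVec q h L' I' J' k') =
      (q / conj q) ^ ((J' - I') / 2 * -k) * if L' = 0 ∧ k' + -k = 0 then 1 else 0 := by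
    rw [eVec_eq, eVec_eq, inner_toGNS, eElem_zero hq hq1, star_toC_dPow,
      toC_dPow_mul_eElem hq hq1 hi', map_smul, haar_eElem hq hq1 hh hi', smul_eq_mul]
  rw [hinner]
  by_cases hLk : L' = 0 ∧ k' + -k = 0
  · obtain ⟨rfl, hk⟩ := hLk
    obtain rfl : I' = 0 := abs_nonpos_iff.1 hi'.1
    obtain rfl : J' = 0 := abs_nonpos_iff.1 hi'.2.1
    rw [if_pos ⟨rfl, hk⟩, if_pos ⟨rfl, rfl, rfl, by omega⟩]
    simp
  · rw [if_neg hLk, if_neg (by omega), mul_zero]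

variable {x : CUq2 q} {ε δ κ : ℤ} {up down upStar downStar : ℤ → ℤ → ℤ → ℂ}

/- Expand `⟪x e, f⟫ = ⟪e, x* f⟫` on both sides: apart from the wanted inner product only inner
products at the levels `L - 1` and `L` occur. -/
theorem OrthonormalAt.inner_eVec_add_one (hx : IsLadder q x ε δ κ up down upStar downStar)
    {L I J : ℤ} (hL : OrthonormalAt h L) (hpred : OrthonormalAt h (L - 1)) (hi : IsIndex L I J)
    (hup : up L I J ≠ 0) {L' I' J' : ℤ} (hi' : IsIndex L' I' J') (k k' : ℤ) :
    inner ℂ (eVec q h (L + 1) (I + ε) (J + δ) (k + κ)) (eVec q h L' I' J' k') =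
      if L + 1 = L' ∧ I + ε = I' ∧ J + δ = J' ∧ k + κ = k' then (1 : ℂ) else 0 := by
  have hadj := inner_toGNS_mul_left h x (eElem q L I J k) (eElem q L' I' J' k')
  rw [hx.mul_eElem hi, hx.star_mul_eElem hi'] at hadj
  simp only [map_add, map_smul, inner_add_left, inner_add_right, inner_smul_left, inner_smul_right,
    ← eVec_eq, hL hi, hpred.inner_eVec hi'] at hadj
  have hdown : (upStar L' I' J' * if L = L' + 1 ∧ I = I' - ε ∧ J = J' - δ ∧ k = k' - κ + 1
      then 1 else 0) = conj (down L I J) *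
        if L - 1 = L' ∧ I + ε = I' ∧ J + δ = J' ∧ k + κ - 1 = k' then 1 else 0 := by
    split_ifs with hleft hright hright
    · obtain ⟨rfl, rfl, rfl, -⟩ := hright
      rw [hx.conj_down]
    · omega
    · omega
    · rw [mul_zero, mul_zero]
  have hup' : (downStar L' I' J' * if L = L' - 1 ∧ I = I' - ε ∧ J = J' - δ ∧ k = k' - κ
      then 1 else 0) = conj (up L I J) *
        if L + 1 = L' ∧ I + ε = I' ∧ J + δ = J' ∧ k + κ = k' then 1 else 0 := by
    split_ifs with hleft hright hright
    · obtain ⟨rfl, rfl, rfl, -⟩ := hright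
      rw [hx.conj_up]
    · omega
    · omega
    · rw [mul_zero, mul_zero]
  refine mul_left_cancel₀ ((map_ne_zero conj).2 hup) ?_
  linear_combination hadj + hdown + hup'

theorem OrthonormalAt.add_one (hq : q ≠ 0) (hq1 : ‖q‖ < 1) {L : ℤ} (hL0 : 0 ≤ L)
    (hL : OrthonormalAt h L) (hpred : OrthonormalAt h (L - 1)) : OrthonormalAt h (L + 1) := by
  intro I J hi k L' I' J' k'
  by_cases hi' : IsIndex L' I' J'
  · obtain ⟨x, ε, δ, κ, up, down, upStar, downStar, hx, hbelow, hup⟩ :=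
      hi.exists_isLadder hq hq1 hL0
    simpa using hL.inner_eVec_add_one hx hpred hbelow hup hi' (k - κ) k'
  · exact inner_eVec_of_not_isIndex hi hi' k k'

theorem orthonormalAt (hq : q ≠ 0) (hq1 : ‖q‖ < 1) (hh : IsHaarState q h) (L : ℤ) :
    OrthonormalAt h L := by
  rcases lt_or_ge L 0 with hL | hL
  · exact orthonormalAt_of_neg hL
  suffices OrthonormalAt h L ∧ OrthonormalAt h (L - 1) from this.1
  induction L, hL using Int.leInduction with
  | base => exact ⟨orthonormalAt_zero hq hq1 hh, orthonormalAt_of_neg (by norm_num)⟩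
  | succ L hL ih => exact ⟨ih.1.add_one hq hq1 hL ih.2, by simpa using ih.1⟩

theorem eFamily_orthonormal (hq : q ≠ 0) (hq1 : ‖q‖ < 1) (hh : IsHaarState q h) :
    Orthonormal ℂ (eFamily q h) := by
  classical
  rw [orthonormal_iff_ite]
  rintro ⟨⟨L, I, J, k⟩, hi⟩ ⟨⟨L', I', J', k'⟩, hi'⟩
  refine (orthonormalAt hq hq1 hh L hi k L' I' J' k').trans (if_congr ?_ rfl rfl)
  exact (Subtype.ext_iff.trans (by simp only [Prod.mk.injEq])).symm

end orthonormal

section total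

theorem mul_mem_of_mem_adjoin {R A : Type*} [CommSemiring R] [StarRing R] [Semiring A] [StarRing A]
    [Algebra R A] [StarModule R A] {S : Set A} {V : Submodule R A}
    (hV : ∀ x ∈ S, ∀ y ∈ V, x * y ∈ V ∧ star x * y ∈ V) {x : A} (hx : x ∈ StarAlgebra.adjoin R S) :
    ∀ y ∈ V, x * y ∈ V := by
  rw [← StarSubalgebra.mem_toSubalgebra, StarAlgebra.adjoin_toSubalgebra] at hx
  induction hx using Algebra.adjoin_induction with
  | mem x hx =>
    intro y hy
    rcases hx with hx | hx
    · exact (hV x hx y hy).1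
    · simpa using (hV (star x) hx y hy).2
  | algebraMap c => exact fun y hy => by simpa [← Algebra.smul_def] using V.smul_mem c hy
  | add x x' _ _ hx hx' => exact fun y hy => by simpa [add_mul] using V.add_mem (hx y hy) (hx' y hy)
  | mul x x' _ _ hx hx' => exact fun y hy => by simpa [mul_assoc] using hx _ (hx' y hy)

variable {q : ℂ}

theorem dense_adjoin_generators :
    Dense (StarAlgebra.adjoin ℂ {gA q, gB q, gD q} : Set (CUq2 q)) := by
  let incl : CUq2 q →⋆ₐ[ℂ] Big q := (univSub q).subtype
  have himage : incl '' (StarAlgebra.adjoin ℂ {gA q, gB q, gD q} : Set (CUq2 q)) =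
      (StarAlgebra.adjoin ℂ {bigA q, bigB q, bigD q} : Set (Big q)) := by
    rw [← StarSubalgebra.coe_map, StarAlgHom.map_adjoin, Set.image_insert_eq, Set.image_pair]
    rfl
  intro x
  refine closure_subtype.2 ?_
  have hx : incl x ∈ closure (StarAlgebra.adjoin ℂ {bigA q, bigB q, bigD q} : Set (Big q)) := x.2
  rwa [← himage] at hx

/-- The linear span of the elements `eElem q L I J k` of `C(U_q(2))`. -/
def eSpan (q : ℂ) : Submodule ℂ (CUq2 q) :=
  Submodule.span ℂ (Set.range fun p : Index => eElem q p.1.1 p.1.2.1 p.1.2.2.1 p.1.2.2.2)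

theorem eElem_mem_eSpan (L I J k : ℤ) : eElem q L I J k ∈ eSpan q := by
  by_cases hi : IsIndex L I J
  · exact Submodule.subset_span ⟨⟨(L, I, J, k), hi⟩, rfl⟩
  · rw [eElem, if_neg hi]
    exact zero_mem _

theorem mul_mem_eSpan {x : CUq2 q}
    (hx : ∀ L I J k, IsIndex L I J → x * eElem q L I J k ∈ eSpan q) {y : CUq2 q}
    (hy : y ∈ eSpan q) : x * y ∈ eSpan q := by
  have hle : eSpan q ≤ (eSpan q).comap (LinearMap.mulLeft ℂ x) :=
    Submodule.span_le.2 (Set.range_subset_iff.2 fun p => hx _ _ _ _ p.2)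
  exact hle hy

theorem IsLadder.mul_mem_eSpan {x : CUq2 q} {ε δ κ : ℤ} {up down upStar downStar : ℤ → ℤ → ℤ → ℂ}
    (hx : IsLadder q x ε δ κ up down upStar downStar) {y : CUq2 q} (hy : y ∈ eSpan q) :
    x * y ∈ eSpan q := by
  refine Uq2.mul_mem_eSpan (fun L I J k hi => ?_) hy
  rw [hx.mul_eElem hi]
  exact add_mem (Submodule.smul_mem _ _ (eElem_mem_eSpan _ _ _ _))
    (Submodule.smul_mem _ _ (eElem_mem_eSpan _ _ _ _))

theorem generator_mul_mem_eSpan (hq : q ≠ 0) (hq1 : ‖q‖ < 1) {x : CUq2 q}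
    (hx : x ∈ ({gA q, gB q, gD q} : Set (CUq2 q))) {y : CUq2 q} (hy : y ∈ eSpan q) :
    x * y ∈ eSpan q ∧ star x * y ∈ eSpan q := by
  rcases hx with rfl | rfl | rfl
  · exact ⟨(isLadder_gA hq hq1).mul_mem_eSpan hy, (isLadder_gA hq hq1).symm.mul_mem_eSpan hy⟩
  · exact ⟨(isLadder_gB hq hq1).mul_mem_eSpan hy, (isLadder_gB hq hq1).symm.mul_mem_eSpan hy⟩
  · constructor <;> refine mul_mem_eSpan (fun L I J k hi => ?_) hy
    · rw [gD_mul_eElem hq hq1 hi]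
      exact Submodule.smul_mem _ _ (eElem_mem_eSpan _ _ _ _)
    · rw [star_gD_mul_eElem hq hq1 hi]
      exact Submodule.smul_mem _ _ (eElem_mem_eSpan _ _ _ _)

theorem dense_eSpan (hq : q ≠ 0) (hq1 : ‖q‖ < 1) : Dense (eSpan q : Set (CUq2 q)) := by
  have hone : (1 : CUq2 q) ∈ eSpan q := by
    simpa [eElem_zero hq hq1, dPow_zero] using eElem_mem_eSpan (q := q) 0 0 0 0
  refine dense_adjoin_generators.mono fun x hx => ?_
  simpa using mul_mem_of_mem_adjoin
    (fun _ hx _ hy => generator_mul_mem_eSpan hq hq1 hx hy) hx 1 hone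

theorem eFamily_total (h : CUq2 q →ₚ[ℂ] ℂ) (hq : q ≠ 0) (hq1 : ‖q‖ < 1) :
    (Submodule.span ℂ (Set.range (eFamily q h))).topologicalClosure = ⊤ := by
  have hspan : Submodule.span ℂ (Set.range (eFamily q h)) = (eSpan q).map (toGNS h) := by
    rw [eSpan, Submodule.map_span, ← Set.range_comp]
    rfl
  rw [← Submodule.dense_iff_topologicalClosure_eq_top, hspan, Submodule.map_coe]
  exact (denseRange_toGNS h).dense_image (continuous_toGNS h) (dense_eSpan hq hq1)

end total

end Uq2

end

theorem mainTheorem3 (q : ℂ) (hq0 : q ≠ 0) (hq1 : ‖q‖ < 1)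
    (h : Uq2.CUq2 q →ₚ[ℂ] ℂ) (hh : Uq2.IsHaarState q h) :
    (Orthonormal ℂ (Uq2.eFamily q h) ∧
      (Submodule.span ℂ (Set.range (Uq2.eFamily q h))).topologicalClosure = ⊤) ∧
    ∀ L I J k : ℤ, Uq2.IsIndex L I J →
      h.gnsStarAlgHom (Uq2.gD q) (Uq2.eVec q h L I J k) =
          (q / star q) ^ ((I - J) / 2) • Uq2.eVec q h L I J (k - 1) ∧
      h.gnsStarAlgHom (star (Uq2.gD q)) (Uq2.eVec q h L I J k) =
          (star q / q) ^ ((I - J) / 2) • Uq2.eVec q h L I J (k + 1) ∧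
      h.gnsStarAlgHom (Uq2.gB q) (Uq2.eVec q h L I J k) =
          Uq2.betaPlus q L I J • Uq2.eVec q h (L + 1) (I - 1) (J + 1) k +
          Uq2.betaMinus q L I J • Uq2.eVec q h (L - 1) (I - 1) (J + 1) (k - 1) ∧
      h.gnsStarAlgHom (star (Uq2.gB q)) (Uq2.eVec q h L I J k) =
          Uq2.betaPlusStar q L I J • Uq2.eVec q h (L + 1) (I + 1) (J - 1) (k + 1) +
          Uq2.betaMinusStar q L I J • Uq2.eVec q h (L - 1) (I + 1) (J - 1) k ∧
      h.gnsStarAlgHom (Uq2.gA q) (Uq2.eVec q h L I J k) =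
          Uq2.alphaPlus q L I J • Uq2.eVec q h (L + 1) (I - 1) (J - 1) k +
          Uq2.alphaMinus q L I J • Uq2.eVec q h (L - 1) (I - 1) (J - 1) (k - 1) ∧
      h.gnsStarAlgHom (star (Uq2.gA q)) (Uq2.eVec q h L I J k) =
          Uq2.alphaPlusStar q L I J • Uq2.eVec q h (L + 1) (I + 1) (J + 1) (k + 1) +
          Uq2.alphaMinusStar q L I J • Uq2.eVec q h (L - 1) (I + 1) (J + 1) k := by
  refine ⟨⟨Uq2.eFamily_orthonormal hq0 hq1 hh, Uq2.eFamily_total h hq0 hq1⟩, ?_⟩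
  intro L I J k hi
  simp only [Uq2.eVec_eq, Uq2.gns_toGNS, ← map_smul, ← map_add]
  exact ⟨congrArg _ (Uq2.gD_mul_eElem hq0 hq1 hi k),
    congrArg _ (Uq2.star_gD_mul_eElem hq0 hq1 hi k),
    congrArg _ (Uq2.gB_mul_eElem hq0 hq1 hi k),
    congrArg _ (Uq2.star_gB_mul_eElem hq0 hq1 hi k),
    congrArg _ (Uq2.gA_mul_eElem hq0 hq1 hi k),
    congrArg _ (Uq2.star_gA_mul_eElem hq0 hq1 hi k)⟩
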